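/- Let $\mathbb{T}=[0,1]/\{0\sim1\}$ and let $\mathrm{Diff}^k(\mathbb{T})$ be the set of orientation-preserving $C^k$-diffeomorphisms of $\mathbb{T}$ ($\phi'>0$), where $\mathrm{Diff}^1(\mathbb{T})$ carries the $C^1$-topology and its Borel $\sigma$-algebra. Let $\mathrm{Diff}^3[0,1]$ be the set of $C^3$-diffeomorphisms $f$ of $[0,1]$ with $f'>0$, $f(0)=0$, $f(1)=1$ ($C^3$ up to the endpoints, with one-sided derivatives there). For a measure $\mu$ on $\mathrm{Diff}^1(\mathbb{T})$ and $f\in\mathrm{Diff}^1(\mathbb{T})$ put $f^*\mu(A)=\mu(\{f\circ\phi:\phi\in A\})$, and let $\mathcal{S}_f=\left(\frac{f''}{f'}\right)'-\frac12\left(\frac{f''}{f'}\right)^2$ be the Schwarzian derivative. Let $\sigma>0$ and $\alpha\in\mathbb{R}_{\ge0}\cup i\mathbb{R}_{\ge0}$, so that $\alpha^2\in\mathbb{R}$ is arbitrary. A Radon measure $\mu$ on $\mathrm{Diff}^1(\mathbb{T})$ is called an (unquotiented Virasoro) $\alpha$-orbital measure if, for every $\psi\in\mathrm{Diff}^3(\mathbb{T})$,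 $\psi^*\mu$ is absolutely continuous with respect to $\mu$ with $$\frac{\mathrm{d}\psi^*\mu}{\mathrm{d}\mu}(\phi)=\exp\left\{\frac1{\sigma^2}\int_{\mathbb{T}}\left[\mathcal{S}_\psi(\phi(\tau))+2\alpha^2\big(\psi'(\phi(\tau))^2-1\big)\right]\phi'(\tau)^2\,\mathrm{d}\tau\right\}.$$ For such $\mu$ and $t_0\in\mathbb{T}$, the $\alpha$-orbital measure pinned at $t_0$ is the image $\mu^{t_0}$ of $\mu$ under $\phi\mapsto\phi-\phi(t_0)$. Let $\mu$ be an $\alpha$-orbital measure, let $t_0\in\mathbb{T}$ and let $f\in\mathrm{Diff}^1(\mathbb{T})\cap\mathrm{Diff}^3[0,1]$; that is, $f\in\mathrm{Diff}^3[0,1]$ and $f'(0)=f'(1)$. Then $f^*\mu^{t_0}$ and $\mu^{t_0}$ are mutually absolutely continuous, and for $\mu^{t_0}$-almost every $\phi$ $$\frac{\mathrm{d}f^*\mu^{t_0}}{\mathrm{d}\mu^{t_0}}(\phi)=\frac1{\sqrt{f'(0)f'(1)}}\exp\left\{\frac1{\sigma^2}\left[\frac{f''(0)}{f'(0)}-\frac{f''(1)}{f'(1)}\right]\phi'(t_0)+\frac1{\sigma^2}\int_{\mathbb{T}\setminus\{t_0\}}\left[\mathcal{S}_f(\phi(\tau))+2\alpha^2\big(f'(\phi(\tau))^2-1\big)\right]\phi'(\tau)^2\,\mathrm{d}\tau\right\}.$$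 -/

import Mathlib

open MeasureTheory Set
open scoped ENNReal

noncomputable section

/-- The circle `𝕋 = [0,1]/{0 ∼ 1}`. -/
abbrev Circ : Type := AddCircle (1 : ℝ)

/-- The representative in `[0,1)` of a point of the circle. -/
def circRep (x : Circ) : ℝ := (AddCircle.equivIco (1 : ℝ) 0 x : ℝ)

/-- The function `F : ℝ → ℝ` is the lift of an orientation-preserving `C^k`-diffeomorphism
of the circle (`k ≥ 1`): it is `C^k`, it has positive derivative and `F (x + 1) = F x + 1`. -/
structure IsCircleLift (k : ℕ) (F : ℝ → ℝ) : Prop where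
  contDiff : ContDiff ℝ k F
  deriv_pos : ∀ x, 0 < deriv F x
  add_one : ∀ x, F (x + 1) = F x + 1

/-- `Diff^k(𝕋)` for `k ≥ 1`: maps `𝕋 → 𝕋` that are induced by a lift as above. -/
structure CircleDiff (k : ℕ) where
  toFun : Circ → Circ
  exists_lift : ∃ F : ℝ → ℝ, IsCircleLift k F ∧ ∀ x : ℝ, toFun (x : Circ) = (F x : Circ)

namespace CircleDiff

variable {k : ℕ}

instance : CoeFun (CircleDiff k) (fun _ => Circ → Circ) := ⟨CircleDiff.toFun⟩

/-- A lift of `φ` to `ℝ`. It is unique up to an additive integer constant, so its derivatives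
do not depend on the choice. -/
def lift (φ : CircleDiff k) : ℝ → ℝ := φ.exists_lift.choose

theorem isCircleLift_lift (φ : CircleDiff k) : IsCircleLift k φ.lift :=
  φ.exists_lift.choose_spec.1

theorem coe_lift (φ : CircleDiff k) (x : ℝ) : φ (x : Circ) = (φ.lift x : Circ) :=
  φ.exists_lift.choose_spec.2 x

theorem periodic_deriv_lift (φ : CircleDiff k) : Function.Periodic (deriv φ.lift) 1 := by
  intro x
  have h : (fun y => φ.lift (y + 1)) = fun y => φ.lift y + 1 :=
    funext φ.isCircleLift_lift.add_one
  have h1 := congrArg (fun G => deriv G x) h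
  simpa [deriv_comp_add_const] using h1

/-- The derivative `φ' : 𝕋 → ℝ`. -/
def deriv (φ : CircleDiff k) : Circ → ℝ := φ.periodic_deriv_lift.lift

/-- A `C^k`-diffeomorphism regarded as a `C^m`-diffeomorphism, `m ≤ k`. -/
def ofLE {m : ℕ} (h : m ≤ k) (φ : CircleDiff k) : CircleDiff m where
  toFun := φ
  exists_lift := ⟨φ.lift,
    ⟨φ.isCircleLift_lift.contDiff.of_le (by exact_mod_cast h), φ.isCircleLift_lift.deriv_pos,
      φ.isCircleLift_lift.add_one⟩, φ.coe_lift⟩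

/-- The composition `ψ ∘ φ`. -/
def comp (ψ φ : CircleDiff k) : CircleDiff k where
  toFun := fun x => ψ (φ x)
  exists_lift := by
    have hψ := ψ.isCircleLift_lift
    have hφ := φ.isCircleLift_lift
    refine ⟨fun x => ψ.lift (φ.lift x), ⟨hψ.contDiff.comp hφ.contDiff, fun x => ?_, fun x => ?_⟩,
      fun x => ?_⟩
    · have h1 := (differentiableAt_of_deriv_ne_zero (hψ.deriv_pos (φ.lift x)).ne').hasDerivAt
      have h2 := (differentiableAt_of_deriv_ne_zero (hφ.deriv_pos x).ne').hasDerivAt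
      have h3 := (h1.comp x h2).deriv
      have h4 : _root_.deriv (fun x => ψ.lift (φ.lift x)) x
          = _root_.deriv ψ.lift (φ.lift x) * _root_.deriv φ.lift x := h3
      rw [h4]
      exact mul_pos (hψ.deriv_pos _) (hφ.deriv_pos _)
    · simp only [hφ.add_one, hψ.add_one]
    · rw [φ.coe_lift, ψ.coe_lift]

/-- The rotated diffeomorphism `φ + θ`. -/
def addConst (φ : CircleDiff k) (θ : Circ) : CircleDiff k where
  toFun := fun x => φ x + θ
  exists_lift := by
    obtain ⟨c, rfl⟩ := QuotientAddGroup.mk_surjective θ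
    have hφ := φ.isCircleLift_lift
    refine ⟨fun x => φ.lift x + c, ⟨hφ.contDiff.add contDiff_const, fun x => ?_, fun x => ?_⟩,
      fun x => ?_⟩
    · simpa using hφ.deriv_pos x
    · rw [hφ.add_one]; ring
    · rw [φ.coe_lift]; rfl

theorem continuous_coe (φ : CircleDiff k) : Continuous φ := by
  rw [(QuotientAddGroup.isQuotientMap_mk (AddSubgroup.zmultiples (1 : ℝ))).continuous_iff]
  have h : (φ.toFun ∘ fun x : ℝ => (x : Circ)) = fun x => (φ.lift x : Circ) :=
    funext φ.coe_lift
  exact h ▸ (AddCircle.continuous_mk' 1).comp φ.isCircleLift_lift.contDiff.continuous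

theorem continuous_deriv (φ : CircleDiff 1) : Continuous φ.deriv := by
  rw [(QuotientAddGroup.isQuotientMap_mk (AddSubgroup.zmultiples (1 : ℝ))).continuous_iff]
  exact φ.isCircleLift_lift.contDiff.continuous_deriv (by simp)

/-- The pair `(φ, φ')` in `C(𝕋, 𝕋) × C(𝕋, ℝ)`. -/
def toC1 (φ : CircleDiff 1) : C(Circ, Circ) × C(Circ, ℝ) :=
  (⟨φ, φ.continuous_coe⟩, ⟨φ.deriv, φ.continuous_deriv⟩)

/-- The `C¹` topology on `Diff¹(𝕋)`: uniform convergence of `φ` and of `φ'`. -/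
instance : TopologicalSpace (CircleDiff 1) := TopologicalSpace.induced toC1 inferInstance

instance : MeasurableSpace (CircleDiff 1) := borel _

instance : BorelSpace (CircleDiff 1) := ⟨rfl⟩

end CircleDiff

/-- The Schwarzian derivative `(f''/f')' - (1/2) (f''/f')²`, with derivatives taken within `s`
(one-sided at the endpoints of an interval). -/
def schwarzianWithin (s : Set ℝ) (f : ℝ → ℝ) (x : ℝ) : ℝ :=
  derivWithin (fun y => iteratedDerivWithin 2 f s y / derivWithin f s y) s x
    - 1 / 2 * (iteratedDerivWithin 2 f s x / derivWithin f s x) ^ 2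

/-- The Schwarzian derivative `𝒮_ψ : 𝕋 → ℝ` of a diffeomorphism of the circle. -/
def CircleDiff.schwarzian {k : ℕ} (ψ : CircleDiff k) (x : Circ) : ℝ :=
  schwarzianWithin univ ψ.lift (circRep x)

/-- `g` restricted to `[0,1]` belongs to `Diff^k[0,1]` for `k ≥ 1`: it is `C^k` up to the
endpoints, it has positive derivative and it fixes `0` and `1`. Nothing relates the derivatives
at the two endpoints. -/
structure IsIntervalDiff (k : ℕ) (g : ℝ → ℝ) : Prop where
  contDiffOn : ContDiffOn ℝ k g (Icc 0 1)
  deriv_pos : ∀ x ∈ Icc (0 : ℝ) 1, 0 < derivWithin g (Icc 0 1) x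
  map_zero : g 0 = 0
  map_one : g 1 = 1

/-- The pullback `f^* μ` under post-composition by `f`, that is `f^* μ (A) = μ (f ∘ A)` where
`f ∘ A = {f ∘ φ | φ ∈ A}`. (Post-composition by `f` is a homeomorphism of `Diff¹(𝕋)`.) -/
def pullbackMeasure (f : CircleDiff 1) (μ : Measure (CircleDiff 1)) : Measure (CircleDiff 1) :=
  Measure.comap (fun φ => f.comp φ) μ

/-- The density in the change of variables formula of orbital measures for post-composition by
`ψ ∈ Diff³(𝕋)`; the real number `a` stands for `α²`. -/
def orbitalDensity (σ a : ℝ) (ψ : CircleDiff 3) (φ : CircleDiff 1) : ℝ :=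
  Real.exp (1 / σ ^ 2 *
    ∫ τ : Circ, (ψ.schwarzian (φ τ) + 2 * a * (ψ.deriv (φ τ) ^ 2 - 1)) * φ.deriv τ ^ 2)

/-- Unquotiented Virasoro `α`-orbital measures with `α² = a`. A Borel measure on the Polish space
`Diff¹(𝕋)` is Radon if and only if it is locally finite. -/
structure IsOrbitalMeasure (σ a : ℝ) (μ : Measure (CircleDiff 1)) : Prop where
  locallyFinite : IsLocallyFiniteMeasure μ
  pullback_eq : ∀ ψ : CircleDiff 3,
    pullbackMeasure (ψ.ofLE (by norm_num)) μ
      = μ.withDensity fun φ => ENNReal.ofReal (orbitalDensity σ a ψ φ)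

/-- The measure `μ` pinned at `t₀`: its image under `φ ↦ φ - φ(t₀)`. -/
def pinnedMeasure (μ : Measure (CircleDiff 1)) (t₀ : Circ) : Measure (CircleDiff 1) :=
  μ.map fun φ => φ.addConst (-φ t₀)

/-- The density in the change of variables formula of pinned orbital measures for post-composition
by the diffeomorphism with restriction `g` to `[0,1]`; the real number `a` stands for `α²`. The
derivatives of `g` at `0` and `1` are one-sided. -/
def pinnedDensity (σ a : ℝ) (t₀ : Circ) (g : ℝ → ℝ) (φ : CircleDiff 1) : ℝ :=
  1 / Real.sqrt (derivWithin g (Icc 0 1) 0 * derivWithin g (Icc 0 1) 1) *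
    Real.exp (
      1 / σ ^ 2 * (iteratedDerivWithin 2 g (Icc 0 1) 0 / derivWithin g (Icc 0 1) 0
        - iteratedDerivWithin 2 g (Icc 0 1) 1 / derivWithin g (Icc 0 1) 1) * φ.deriv t₀
      + 1 / σ ^ 2 * ∫ τ in ({t₀}ᶜ : Set Circ),
          (schwarzianWithin (Icc 0 1) g (circRep (φ τ))
            + 2 * a * (derivWithin g (Icc 0 1) (circRep (φ τ)) ^ 2 - 1)) * φ.deriv τ ^ 2)

end

open Filter Topology
open scoped NNReal BoundedContinuousFunction

/-! ### Lifts of circle maps -/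

/-! The lift `F` of `f` with `F = g` on `[0,1]` is `C¹` and is `C³` between consecutive integers; at
the integers `F''/F'` may jump, by `J = g''(0)/g'(0) - g''(1)/g'(1)`. As a distribution, its
Schwarzian is therefore that of `g` plus `J` times a Dirac mass at the integers. Evaluated along a
`φ` with `φ(t₀) = 0` and integrated against `φ'²`, the Dirac mass contributes `φ'(t₀)²/φ'(t₀) =
φ'(t₀)`: this is the boundary term of the density.

To make this rigorous, `F` is approximated by `C³` lifts `Fₙ`, built by prescribing `(Fₙ''/Fₙ')'` as
a continuous periodic function in which the Dirac mass is replaced by a bump of width `δₙ`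
(`exists_isSmoothing`). Then `Fₙ → F` in `C¹`, and the orbital densities converge pointwise with a
bound that is uniform where `φ'` is bounded (`tendsto_orbitalDensity`, `orbitalDensity_rot_mul_le`).

The prefactor comes from pinning. Rotations have density `1`, so `μ` is rotation invariant and is
the product of Haar measure and the pinned measure `ν` (`lintegral_eq_lintegral_pinned`). A smooth
`ψ` with lift fixing `0` maps the arc `(0, ε]` of values of `φ(t₀)` onto `(0, F(ε)]`; testing the
formula for `μ` on this arc expresses `F(ε) ∫ H dν` as an integral over `θ ∈ (0, ε]`
(`lintegral_pinned_arc`). Applied to `Fₙ` and divided by `εₙ → 0`, the left factor tends to `F'(0) =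
√(f'(0) f'(1))`, while the averages on the right tend to the integral of the limit density times
`H(f ∘ φ)` (`lintegral_pinned_eq`). Since `ν` is only locally finite, `H` is supported in a small
open set, and such `H` suffice to identify the measures (`ext_of_forall_lintegral_eq_locally`). -/

theorem coe_circ_eq_iff {x y : ℝ} : (x : Circ) = (y : Circ) ↔ ∃ n : ℤ, x = y + n := by
  rw [← sub_eq_zero, ← AddCircle.coe_sub, AddCircle.coe_eq_zero_iff]
  constructor
  · rintro ⟨n, hn⟩
    exact ⟨n, by simp at hn; linarith⟩
  · rintro ⟨n, hn⟩
    exact ⟨n, by simp; linarith⟩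

/-- Two continuous functions that agree modulo `1` on a preconnected set differ by an integer. -/
theorem exists_int_eqOn_of_coe_eq {F G : ℝ → ℝ} {s : Set ℝ} (hs : IsPreconnected s)
    (hF : ContinuousOn F s) (hG : ContinuousOn G s) (h : ∀ x ∈ s, (F x : Circ) = (G x : Circ)) :
    ∃ n : ℤ, ∀ x ∈ s, F x = G x + n := by
  have hd : IsDiscrete (range ((↑) : ℤ → ℝ)) :=
    Int.isClosedEmbedding_coe_real.isInducing.isDiscrete_range
  obtain ⟨y, ⟨n, rfl⟩, hn⟩ := hs.eqOn_const_of_mapsTo hd (hF.sub hG) (f := fun x => F x - G x)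
    (fun x hx => by
      obtain ⟨n, hn⟩ := coe_circ_eq_iff.1 (h x hx)
      exact ⟨n, by simp only [hn]; ring⟩) (range_nonempty _)
  exact ⟨n, fun x hx => by have := hn hx; simp only [Function.const] at this; linarith⟩

theorem circRep_coe (x : ℝ) : circRep (x : Circ) = Int.fract x := by
  rw [circRep, AddCircle.coe_equivIco_mk_apply]
  simp

theorem coe_circRep (x : Circ) : ((circRep x : ℝ) : Circ) = x := by
  rw [circRep, AddCircle.coe_equivIco]

theorem continuous_circ_iff {X : Type*} [TopologicalSpace X] {f : Circ → X} :
    Continuous f ↔ Continuous fun x : ℝ => f (x : Circ) :=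
  (QuotientAddGroup.isQuotientMap_mk (AddSubgroup.zmultiples (1 : ℝ))).continuous_iff

theorem exists_coe_circ (t : Circ) : ∃ x : ℝ, (x : Circ) = t := ⟨circRep t, coe_circRep t⟩

namespace IsCircleLift

variable {k : ℕ} {F : ℝ → ℝ}

theorem continuous (hF : IsCircleLift k F) : Continuous F := hF.contDiff.continuous

theorem strictMono (hF : IsCircleLift k F) : StrictMono F := strictMono_of_deriv_pos hF.deriv_pos

theorem hasDerivAt (hF : IsCircleLift k F) (x : ℝ) : HasDerivAt F (deriv F x) x :=
  (differentiableAt_of_deriv_ne_zero (hF.deriv_pos x).ne').hasDerivAt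

theorem add_int (hF : IsCircleLift k F) (x : ℝ) (n : ℤ) : F (x + n) = F x + n := by
  have h : Function.Periodic (fun x => F x - x) 1 := fun x => by simp only [hF.add_one]; ring
  have := h.int_mul n x
  simp only [mul_one] at this
  linarith

theorem surjective (hF : IsCircleLift k F) : Function.Surjective F := by
  intro y
  obtain ⟨n, hn⟩ := exists_int_gt (y - F 0)
  obtain ⟨m, hm⟩ := exists_int_lt (y - F 0)
  have h1 := hF.add_int 0 n
  have h2 := hF.add_int 0 m
  exact mem_range_of_exists_le_of_exists_ge hF.continuous
    ⟨0 + m, by linarith⟩ ⟨0 + n, by linarith⟩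

theorem coe_eq_coe (hF : IsCircleLift k F) {x y : ℝ} (h : (x : Circ) = (y : Circ)) :
    (F x : Circ) = (F y : Circ) := by
  obtain ⟨n, rfl⟩ := coe_circ_eq_iff.1 h
  exact coe_circ_eq_iff.2 ⟨n, hF.add_int y n⟩

theorem periodic_deriv (hF : IsCircleLift k F) : Function.Periodic (deriv F) 1 := by
  intro x
  have h : (fun y => F (y + 1)) = fun y => F y + 1 := funext hF.add_one
  have h1 := congrArg (fun G => deriv G x) h
  simpa [deriv_comp_add_const] using h1

theorem continuous_deriv (hF : IsCircleLift k F) (hk : 1 ≤ k) : Continuous (deriv F) :=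
  hF.contDiff.continuous_deriv (by exact_mod_cast hk)

/-- The inverse of a lift. -/
noncomputable def symm (hF : IsCircleLift k F) : ℝ ≃o ℝ :=
  (hF.strictMono.orderIsoOfSurjective F hF.surjective).symm

theorem apply_symm (hF : IsCircleLift k F) (y : ℝ) : F (hF.symm y) = y :=
  (hF.strictMono.orderIsoOfSurjective F hF.surjective).apply_symm_apply y

theorem symm_apply (hF : IsCircleLift k F) (x : ℝ) : hF.symm (F x) = x :=
  hF.strictMono.injective (hF.apply_symm _)

theorem hasDerivAt_symm (hF : IsCircleLift k F) (y : ℝ) :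
    HasDerivAt hF.symm (deriv F (hF.symm y))⁻¹ y :=
  HasDerivAt.of_local_left_inverse hF.symm.continuous.continuousAt (hF.hasDerivAt _)
    (hF.deriv_pos _).ne' (Eventually.of_forall hF.apply_symm)

theorem isCircleLift_symm (hF : IsCircleLift 1 F) : IsCircleLift 1 hF.symm where
  contDiff := by
    rw [Nat.cast_one, contDiff_one_iff_deriv]
    refine ⟨fun y => (hF.hasDerivAt_symm y).differentiableAt, ?_⟩
    rw [show deriv hF.symm = fun y => (deriv F (hF.symm y))⁻¹ from
      funext fun y => (hF.hasDerivAt_symm y).deriv]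
    exact ((hF.continuous_deriv le_rfl).comp hF.symm.continuous).inv₀
      fun y => (hF.deriv_pos _).ne'
  deriv_pos y := by
    rw [(hF.hasDerivAt_symm y).deriv]
    exact inv_pos.2 (hF.deriv_pos _)
  add_one y := hF.strictMono.injective (by rw [hF.apply_symm, hF.add_one, hF.apply_symm])

end IsCircleLift

namespace CircleDiff

variable {k : ℕ}

theorem ext_toFun {φ ψ : CircleDiff k} (h : ∀ x, φ x = ψ x) : φ = ψ := by
  cases φ; cases ψ; congr; exact funext h

/-- The circle diffeomorphism induced by a lift. -/
noncomputable def ofLift (F : ℝ → ℝ) (hF : IsCircleLift k F) : CircleDiff k where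
  toFun := fun x => (F (circRep x) : Circ)
  exists_lift := ⟨F, hF, fun _ => hF.coe_eq_coe (coe_circRep _)⟩

theorem ofLift_coe (F : ℝ → ℝ) (hF : IsCircleLift k F) (x : ℝ) :
    ofLift F hF (x : Circ) = (F x : Circ) := hF.coe_eq_coe (coe_circRep _)

/-- The lift attached to `φ` is an arbitrary choice. Continuity makes the integer ambiguity
constant, so derivatives and Schwarzians may be computed with any convenient lift. -/
theorem exists_lift_eq_add {φ : CircleDiff k} {F : ℝ → ℝ} (hF : Continuous F)
    (h : ∀ x : ℝ, φ (x : Circ) = (F x : Circ)) : ∃ n : ℤ, φ.lift = fun x => F x + n := by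
  obtain ⟨n, hn⟩ := exists_int_eqOn_of_coe_eq isPreconnected_univ
    φ.isCircleLift_lift.continuous.continuousOn hF.continuousOn
    (fun x _ => by rw [← φ.coe_lift, h])
  exact ⟨n, funext fun x => hn x (mem_univ x)⟩

theorem deriv_coe {φ : CircleDiff k} {F : ℝ → ℝ} (hF : Continuous F)
    (h : ∀ x : ℝ, φ (x : Circ) = (F x : Circ)) (x : ℝ) :
    φ.deriv (x : Circ) = _root_.deriv F x := by
  obtain ⟨n, hn⟩ := exists_lift_eq_add hF h
  change _root_.deriv φ.lift x = _
  rw [hn, deriv_add_const]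

theorem deriv_coe_lift (φ : CircleDiff k) (x : ℝ) :
    φ.deriv (x : Circ) = _root_.deriv φ.lift x := rfl

theorem deriv_pos (φ : CircleDiff k) (t : Circ) : 0 < φ.deriv t := by
  obtain ⟨x, rfl⟩ := exists_coe_circ t
  exact φ.isCircleLift_lift.deriv_pos x

theorem deriv_comp (ψ φ : CircleDiff k) (t : Circ) :
    (ψ.comp φ).deriv t = ψ.deriv (φ t) * φ.deriv t := by
  obtain ⟨x, rfl⟩ := exists_coe_circ t
  have hψ := ψ.isCircleLift_lift
  have hφ := φ.isCircleLift_lift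
  rw [deriv_coe (F := fun x => ψ.lift (φ.lift x)) (hψ.continuous.comp hφ.continuous)
    (fun x => by change ψ (φ _) = _; rw [φ.coe_lift, ψ.coe_lift]), φ.coe_lift, deriv_coe_lift,
    deriv_coe_lift]
  exact ((hψ.hasDerivAt _).comp x (hφ.hasDerivAt x)).deriv

theorem deriv_addConst (φ : CircleDiff k) (θ t : Circ) : (φ.addConst θ).deriv t = φ.deriv t := by
  obtain ⟨x, rfl⟩ := exists_coe_circ t
  obtain ⟨c, rfl⟩ := exists_coe_circ θ
  rw [deriv_coe (F := fun x => φ.lift x + c)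
    (φ.isCircleLift_lift.continuous.add continuous_const)
    (fun x => by change φ _ + _ = _; rw [φ.coe_lift, AddCircle.coe_add]), deriv_coe_lift,
    deriv_add_const]

/-! ### The topological group `Diff¹(𝕋)` -/

theorem isInducing_toC1 : IsInducing toC1 := ⟨rfl⟩

theorem injective_toC1 : Function.Injective toC1 := fun _ _ h =>
  ext_toFun fun x => congrArg (fun p => p.1 x) h

theorem isEmbedding_toC1 : IsEmbedding toC1 := ⟨isInducing_toC1, injective_toC1⟩

instance : SecondCountableTopology (CircleDiff 1) := isEmbedding_toC1.secondCountableTopology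

instance : TopologicalSpace.MetrizableSpace (CircleDiff 1) := isEmbedding_toC1.metrizableSpace

theorem continuous_iff_toC1 {X : Type*} [TopologicalSpace X] {f : X → CircleDiff 1} :
    Continuous f ↔ Continuous (fun x => (toC1 (f x)).1) ∧ Continuous fun x => (toC1 (f x)).2 := by
  rw [isInducing_toC1.continuous_iff, ← continuous_prodMk]
  rfl

theorem continuous_fst_toC1 : Continuous fun φ : CircleDiff 1 => (toC1 φ).1 :=
  (continuous_iff_toC1.1 continuous_id).1

theorem continuous_snd_toC1 : Continuous fun φ : CircleDiff 1 => (toC1 φ).2 :=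
  (continuous_iff_toC1.1 continuous_id).2

theorem continuous_eval : Continuous fun p : CircleDiff 1 × Circ => p.1 p.2 :=
  (continuous_fst_toC1.comp continuous_fst).eval continuous_snd

theorem continuous_eval_deriv : Continuous fun p : CircleDiff 1 × Circ => p.1.deriv p.2 :=
  (continuous_snd_toC1.comp continuous_fst).eval continuous_snd

/-- The inverse diffeomorphism. -/
noncomputable def inv (φ : CircleDiff 1) : CircleDiff 1 :=
  ofLift _ φ.isCircleLift_lift.isCircleLift_symm

theorem inv_apply_apply (φ : CircleDiff 1) (t : Circ) : φ.inv (φ t) = t := by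
  obtain ⟨x, rfl⟩ := exists_coe_circ t
  rw [φ.coe_lift, inv, ofLift_coe, φ.isCircleLift_lift.symm_apply]

theorem apply_inv_apply (φ : CircleDiff 1) (t : Circ) : φ (φ.inv t) = t := by
  obtain ⟨x, rfl⟩ := exists_coe_circ t
  rw [inv, ofLift_coe, φ.coe_lift, φ.isCircleLift_lift.apply_symm]

/-- The identity diffeomorphism. -/
def refl : CircleDiff 1 where
  toFun := fun x => x
  exists_lift := ⟨fun x => x, ⟨contDiff_id, fun x => by simp, fun x => rfl⟩, fun _ => rfl⟩

/-- With the topological group structure, post-composition is a homeomorphism and pinning is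
multiplication by a rotation. -/
noncomputable instance : Group (CircleDiff 1) where
  mul := comp
  one := refl
  inv := inv
  mul_assoc _ _ _ := rfl
  one_mul _ := rfl
  mul_one _ := rfl
  inv_mul_cancel φ := ext_toFun φ.inv_apply_apply

theorem mul_def (ψ φ : CircleDiff 1) : ψ * φ = ψ.comp φ := rfl

theorem mul_apply (ψ φ : CircleDiff 1) (t : Circ) : (ψ * φ) t = ψ (φ t) := rfl

theorem apply_inv_self (φ : CircleDiff 1) (t : Circ) : φ (φ⁻¹ t) = t := φ.apply_inv_apply t

theorem deriv_one (t : Circ) : (1 : CircleDiff 1).deriv t = 1 := by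
  obtain ⟨x, rfl⟩ := exists_coe_circ t
  rw [deriv_coe continuous_id (fun _ => rfl), deriv_id]

theorem deriv_inv (φ : CircleDiff 1) (t : Circ) : φ⁻¹.deriv t = (φ.deriv (φ⁻¹ t))⁻¹ := by
  have h := deriv_comp φ φ⁻¹ t
  rw [← mul_def, mul_inv_cancel, deriv_one] at h
  exact eq_inv_of_mul_eq_one_right h.symm

/-- The preimage of a closed `C` is the projection, along the compact circle, of the closed set of
triples `(φ, y, x)` with `φ x = y` and `x ∈ C`; such projections are closed maps. -/
theorem continuous_inv_eval : Continuous fun p : CircleDiff 1 × Circ => p.1⁻¹ p.2 := by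
  refine continuous_iff_isClosed.2 fun C hC => ?_
  have h1 : IsClosed {q : (CircleDiff 1 × Circ) × Circ | q.1.1 q.2 = q.1.2 ∧ q.2 ∈ C} := by
    refine (isClosed_eq ?_ ?_).inter (hC.preimage continuous_snd)
    · exact continuous_eval.comp
        ((continuous_fst.comp continuous_fst).prodMk continuous_snd)
    · exact continuous_snd.comp continuous_fst
  have h2 := isClosedMap_fst_of_compactSpace _ h1
  convert h2 using 1
  ext ⟨φ, y⟩
  constructor
  · intro h
    exact ⟨((φ, y), φ⁻¹ y), ⟨φ.apply_inv_self y, h⟩, rfl⟩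
  · rintro ⟨⟨⟨φ', y'⟩, x⟩, ⟨h3, h4⟩, h5⟩
    obtain ⟨rfl, rfl⟩ := Prod.mk.inj h5
    simp only at h3 h4
    change φ'⁻¹ y' ∈ C
    rw [← h3]
    exact (φ'.inv_apply_apply x).symm ▸ h4

instance : IsTopologicalGroup (CircleDiff 1) where
  continuous_mul := by
    refine continuous_iff_toC1.2 ⟨?_, ?_⟩
    · exact ContinuousMap.continuous_of_continuous_uncurry _ (continuous_eval.comp
        ((continuous_fst.comp continuous_fst).prodMk (continuous_eval.comp
          ((continuous_snd.comp continuous_fst).prodMk continuous_snd))))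
    · refine ContinuousMap.continuous_of_continuous_uncurry _ ?_
      have : (Function.uncurry fun (p : CircleDiff 1 × CircleDiff 1) (t : Circ) =>
          (toC1 (p.1 * p.2)).2 t)
          = fun q => q.1.1.deriv (q.1.2 q.2) * q.1.2.deriv q.2 :=
        funext fun q => deriv_comp _ _ _
      rw [this]
      exact (continuous_eval_deriv.comp ((continuous_fst.comp continuous_fst).prodMk
        (continuous_eval.comp ((continuous_snd.comp continuous_fst).prodMk continuous_snd)))).mul
        (continuous_eval_deriv.comp ((continuous_snd.comp continuous_fst).prodMk continuous_snd))
  continuous_inv := by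
    refine continuous_iff_toC1.2 ⟨?_, ?_⟩
    · exact ContinuousMap.continuous_of_continuous_uncurry _ continuous_inv_eval
    · refine ContinuousMap.continuous_of_continuous_uncurry _ ?_
      have : (Function.uncurry fun (φ : CircleDiff 1) (t : Circ) => (toC1 φ⁻¹).2 t)
          = fun q => (q.1.deriv (q.1⁻¹ q.2))⁻¹ := funext fun q => deriv_inv _ _
      rw [this]
      exact (continuous_eval_deriv.comp (continuous_fst.prodMk continuous_inv_eval)).inv₀
        fun q => (deriv_pos _ _).ne'

/-- The rotation by `θ`. -/
noncomputable def rot (θ : Circ) : CircleDiff 1 := (1 : CircleDiff 1).addConst θ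

theorem rot_apply (θ t : Circ) : rot θ t = t + θ := rfl

theorem rot_mul (θ : Circ) (φ : CircleDiff 1) : rot θ * φ = φ.addConst θ := rfl

theorem rot_mul_rot (θ θ' : Circ) : rot θ * rot θ' = rot (θ' + θ) :=
  ext_toFun fun t => by simp only [mul_apply, rot_apply]; exact add_assoc _ _ _

theorem continuous_rot : Continuous rot := by
  refine continuous_iff_toC1.2 ⟨?_, ?_⟩
  · exact ContinuousMap.continuous_of_continuous_uncurry _ (continuous_snd.add continuous_fst)
  · refine ContinuousMap.continuous_of_continuous_uncurry _ ?_
    have : (Function.uncurry fun (θ : Circ) (t : Circ) => (toC1 (rot θ)).2 t) = fun _ => 1 :=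
      funext fun q => (deriv_addConst _ _ _).trans (deriv_one _)
    rw [this]
    exact continuous_const

end CircleDiff

/-! ### The densities in terms of lifts -/

theorem Function.Periodic.periodic_deriv {f : ℝ → ℝ} {c : ℝ} (hf : Function.Periodic f c) :
    Function.Periodic (deriv f) c := by
  intro x
  have h := congrArg (fun G => deriv G x) (funext hf : (fun y => f (y + c)) = f)
  simpa [deriv_comp_add_const] using h

theorem Function.Periodic.apply_fract {X : Type*} {f : ℝ → X} (hf : Function.Periodic f 1)
    (x : ℝ) : f (Int.fract x) = f x := by
  have := hf.sub_int_mul_eq (x := x) ⌊x⌋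
  rwa [mul_one] at this

theorem schwarzianWithin_univ (F : ℝ → ℝ) : schwarzianWithin univ F = fun x =>
    deriv (fun y => deriv (deriv F) y / deriv F y) x
      - 1 / 2 * (deriv (deriv F) x / deriv F x) ^ 2 := by
  have h2 : iteratedDeriv 2 F = deriv (deriv F) := by
    rw [iteratedDeriv_succ, iteratedDeriv_one]
  funext x
  simp only [schwarzianWithin, derivWithin_univ, iteratedDerivWithin_univ, h2]

theorem schwarzianWithin_univ_add_const (F : ℝ → ℝ) (c : ℝ) :
    schwarzianWithin univ (fun x => F x + c) = schwarzianWithin univ F := by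
  have h : deriv (fun x => F x + c) = deriv F := funext fun x => deriv_add_const c
  simp only [schwarzianWithin_univ, h]

namespace IsCircleLift

variable {F : ℝ → ℝ}

theorem periodic_schwarzianWithin {k : ℕ} (hF : IsCircleLift k F) :
    Function.Periodic (schwarzianWithin univ F) 1 := by
  have h1 := hF.periodic_deriv
  have h2 := h1.periodic_deriv
  have h3 : Function.Periodic (fun y => deriv (deriv F) y / deriv F y) 1 := fun x => by
    simp only [h1 x, h2 x]
  intro x
  simp only [schwarzianWithin_univ, h1 x, h2 x, h3.periodic_deriv x]

theorem continuous_schwarzianWithin (hF : IsCircleLift 3 F) :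
    Continuous (schwarzianWithin univ F) := by
  have h0 : ContDiff ℝ (2 + 1) F := hF.contDiff
  have h1 : ContDiff ℝ (1 + 1) (deriv F) := (contDiff_succ_iff_deriv.1 h0).2.2
  have h2 : ContDiff ℝ 1 (deriv (deriv F)) := (contDiff_succ_iff_deriv.1 h1).2.2
  have h3 : ContDiff ℝ 1 (fun y => deriv (deriv F) y / deriv F y) :=
    h2.div (h1.of_le (by norm_num)) fun x => (hF.deriv_pos x).ne'
  rw [schwarzianWithin_univ]
  exact (h3.continuous_deriv le_rfl).sub (continuous_const.mul (h3.continuous.congr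
    (fun x => by rfl) |>.pow 2))

end IsCircleLift

theorem CircleDiff.schwarzian_coe {k : ℕ} {ψ : CircleDiff k} {F : ℝ → ℝ} (hF : IsCircleLift k F)
    (h : ∀ x : ℝ, ψ (x : Circ) = (F x : Circ)) (x : ℝ) :
    ψ.schwarzian (x : Circ) = schwarzianWithin univ F x := by
  obtain ⟨n, hn⟩ := exists_lift_eq_add hF.continuous h
  rw [CircleDiff.schwarzian, circRep_coe, hn, schwarzianWithin_univ_add_const,
    hF.periodic_schwarzianWithin.apply_fract]

/-- The function that is integrated against `φ'(τ)²` in the density of orbital measures. -/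
noncomputable def orbitalPotential (a : ℝ) (F : ℝ → ℝ) (x : ℝ) : ℝ :=
  schwarzianWithin univ F x + 2 * a * (deriv F x ^ 2 - 1)

/-- The free base point `t` lets the period be centred at the pinning point later, away from the
other integer values of the lift. -/
theorem orbitalDensity_eq (σ a : ℝ) {ψ : CircleDiff 3} {φ : CircleDiff 1} {F G : ℝ → ℝ}
    (hF : IsCircleLift 3 F) (hψ : ∀ x : ℝ, ψ (x : Circ) = (F x : Circ))
    (hG : Continuous G) (hφ : ∀ x : ℝ, φ (x : Circ) = (G x : Circ)) (t : ℝ) :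
    orbitalDensity σ a ψ φ = Real.exp (1 / σ ^ 2 *
      ∫ τ in t..t + 1, orbitalPotential a F (G τ) * deriv G τ ^ 2) := by
  rw [orbitalDensity, ← AddCircle.intervalIntegral_preimage 1 t]
  congr 2
  refine intervalIntegral.integral_congr fun τ _ => ?_
  simp only [hφ, CircleDiff.deriv_coe hG hφ, CircleDiff.deriv_coe hF.continuous hψ,
    CircleDiff.schwarzian_coe hF hψ, orbitalPotential]

theorem continuous_integral_continuousMap {X : Type*} [TopologicalSpace X] [CompactSpace X]
    [MeasurableSpace X] [BorelSpace X] (μ : Measure X) [IsFiniteMeasure μ] :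
    Continuous fun f : C(X, ℝ) => ∫ x, f x ∂μ := by
  refine (LipschitzWith.of_dist_le_mul (K := ⟨μ.real univ, measureReal_nonneg⟩)
    fun f g => ?_).continuous
  have hf (f : C(X, ℝ)) : Integrable f μ :=
    Integrable.of_bound f.continuous.aestronglyMeasurable ‖f‖
      (Eventually.of_forall f.norm_coe_le_norm)
  rw [dist_eq_norm, ← integral_sub (hf f) (hf g), mul_comm, dist_eq_norm]
  exact norm_integral_le_of_norm_le_const (Eventually.of_forall (f - g).norm_coe_le_norm)

theorem continuous_orbitalDensity (σ a : ℝ) (ψ : CircleDiff 3) :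
    Continuous (orbitalDensity σ a ψ) := by
  have h1 : Continuous ψ.schwarzian := continuous_circ_iff.2 <| by
    simp only [CircleDiff.schwarzian_coe ψ.isCircleLift_lift ψ.coe_lift]
    exact ψ.isCircleLift_lift.continuous_schwarzianWithin
  have h2 : Continuous ψ.deriv := continuous_circ_iff.2 <|
    ψ.isCircleLift_lift.continuous_deriv (by norm_num)
  have h3 : Continuous fun p : CircleDiff 1 × Circ =>
      (ψ.schwarzian (p.1 p.2) + 2 * a * (ψ.deriv (p.1 p.2) ^ 2 - 1)) * p.1.deriv p.2 ^ 2 := by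
    have := CircleDiff.continuous_eval
    have := CircleDiff.continuous_eval_deriv
    fun_prop
  have h4 : Continuous fun φ : CircleDiff 1 => (⟨fun τ => (ψ.schwarzian (φ τ)
      + 2 * a * (ψ.deriv (φ τ) ^ 2 - 1)) * φ.deriv τ ^ 2,
        h3.comp (Continuous.prodMk_right φ)⟩ : C(Circ, ℝ)) :=
    ContinuousMap.continuous_of_continuous_uncurry _ h3
  exact Real.continuous_exp.comp (continuous_const.mul
    ((continuous_integral_continuousMap volume).comp h4))

theorem ae_ne_circ (t : Circ) : ∀ᵐ τ : Circ, τ ≠ t := by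
  obtain ⟨x, rfl⟩ := exists_coe_circ t
  have h := (AddCircle.measurePreserving_mk 1 x).map_eq
  have hs : MeasurableSet {τ : Circ | τ ≠ (x : Circ)} := (isClosed_singleton.measurableSet).compl
  rw [← h, ae_map_iff (AddCircle.measurable_mk').aemeasurable hs, ae_restrict_iff' measurableSet_Ioc]
  have h1 : ∀ᵐ y : ℝ, y ≠ x + 1 := by simp [ae_iff]
  filter_upwards [h1] with y hy hy'
  intro h2
  obtain ⟨n, hn⟩ := coe_circ_eq_iff.1 h2
  obtain ⟨h3, h4⟩ := hy'
  have h5 : 0 < n := by exact_mod_cast (by linarith : (0 : ℝ) < n)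
  have h6 : n ≤ 1 := by exact_mod_cast (by linarith : (n : ℝ) ≤ 1)
  obtain rfl : n = 1 := by omega
  exact hy (by simpa using hn)

/-- The limit potential for a diffeomorphism of `[0, 1]`, extended periodically. -/
noncomputable def pinnedPotential (a : ℝ) (g : ℝ → ℝ) (x : ℝ) : ℝ :=
  schwarzianWithin (Icc 0 1) g (Int.fract x)
    + 2 * a * (derivWithin g (Icc 0 1) (Int.fract x) ^ 2 - 1)

theorem pinnedDensity_eq (σ a : ℝ) (g : ℝ → ℝ) {φ : CircleDiff 1} {G : ℝ → ℝ}
    (hG : Continuous G) (hφ : ∀ x : ℝ, φ (x : Circ) = (G x : Circ)) (t₀ t : ℝ) :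
    pinnedDensity σ a t₀ g φ =
      1 / Real.sqrt (derivWithin g (Icc 0 1) 0 * derivWithin g (Icc 0 1) 1) *
        Real.exp (1 / σ ^ 2 * ((iteratedDerivWithin 2 g (Icc 0 1) 0 / derivWithin g (Icc 0 1) 0
          - iteratedDerivWithin 2 g (Icc 0 1) 1 / derivWithin g (Icc 0 1) 1) * deriv G t₀
          + ∫ τ in t..t + 1, pinnedPotential a g (G τ) * deriv G τ ^ 2)) := by
  -- A point is null, so removing `t₀` does not affect the integral.
  have h1 : (volume : Measure Circ).restrict {(t₀ : Circ)}ᶜ = volume :=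
    Measure.restrict_eq_self_of_ae_mem (ae_ne_circ t₀)
  rw [pinnedDensity, h1, ← AddCircle.intervalIntegral_preimage 1 t, CircleDiff.deriv_coe hG hφ]
  congr 2
  rw [mul_add, mul_assoc]
  congr 2
  refine intervalIntegral.integral_congr fun τ _ => ?_
  simp only [hφ, CircleDiff.deriv_coe hG hφ, circRep_coe, pinnedPotential]

/-! ### Disintegration of orbital measures along rotations -/

/-- Left multiplication by `f` is a measurable equivalence, so pulling back along it is inverse to
pushing forward. This turns the formulas into identities of integrals. -/
theorem pullbackMeasure_eq_iff {f : CircleDiff 1} {μ ρ : Measure (CircleDiff 1)} :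
    pullbackMeasure f μ = ρ ↔ ρ.map (f * ·) = μ := by
  set e := (Homeomorph.mulLeft f).toMeasurableEquiv
  have h1 : pullbackMeasure f μ = μ.map e.symm := (MeasurableEquiv.map_symm e).symm
  rw [h1]
  rw [eq_comm, ← MeasurableEquiv.map_apply_eq_iff_map_symm_apply_eq e]
  rfl

namespace IsOrbitalMeasure

variable {σ a : ℝ} {μ : Measure (CircleDiff 1)}

theorem sigmaFinite (hμ : IsOrbitalMeasure σ a μ) : SigmaFinite μ :=
  have := hμ.locallyFinite
  inferInstance

theorem lintegral_eq (hμ : IsOrbitalMeasure σ a μ) (ψ : CircleDiff 3)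
    {h : CircleDiff 1 → ℝ≥0∞} (hh : Measurable h) :
    ∫⁻ φ, h φ ∂μ = ∫⁻ φ, ENNReal.ofReal (orbitalDensity σ a ψ φ)
      * h (ψ.ofLE (by norm_num : 1 ≤ 3) * φ) ∂μ := by
  have hD : Measurable fun φ => ENNReal.ofReal (orbitalDensity σ a ψ φ) :=
    (continuous_orbitalDensity σ a ψ).measurable.ennreal_ofReal
  have hm : Measurable fun φ => ψ.ofLE (by norm_num : 1 ≤ 3) * φ :=
    (continuous_const_mul _).measurable
  conv_lhs => rw [← pullbackMeasure_eq_iff.1 (hμ.pullback_eq ψ)]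
  rw [lintegral_map hh hm, lintegral_withDensity_eq_lintegral_mul _ hD
    (g := fun φ => h (ψ.ofLE (by norm_num : 1 ≤ 3) * φ)) (hh.comp hm)]
  rfl

/-- A rotation has vanishing Schwarzian and derivative `1`, so its orbital density is `1` for every
value of `a`. -/
theorem map_rot_mul (hμ : IsOrbitalMeasure σ a μ) (θ : Circ) :
    μ.map (CircleDiff.rot θ * ·) = μ := by
  obtain ⟨c, rfl⟩ := exists_coe_circ θ
  have hF : IsCircleLift 3 (fun x : ℝ => x + c) :=
    ⟨contDiff_id.add contDiff_const, fun x => by simp, fun x => by ring⟩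
  set ψ := CircleDiff.ofLift _ hF
  have hψ : ∀ x : ℝ, ψ (x : Circ) = ((x + c : ℝ) : Circ) := CircleDiff.ofLift_coe _ hF
  have h1 : orbitalDensity σ a ψ = fun _ => 1 := by
    funext φ
    have hd : deriv (fun x : ℝ => x + c) = fun _ => 1 := by funext x; simp
    rw [orbitalDensity_eq σ a hF hψ φ.isCircleLift_lift.continuous φ.coe_lift 0]
    simp [orbitalPotential, schwarzianWithin_univ, hd]
  have h2 : ψ.ofLE (by norm_num : 1 ≤ 3) = CircleDiff.rot c := by
    refine CircleDiff.ext_toFun fun t => ?_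
    obtain ⟨x, rfl⟩ := exists_coe_circ t
    exact hψ x
  have h3 := pullbackMeasure_eq_iff.1 (hμ.pullback_eq ψ)
  rw [h2, h1] at h3
  simpa using! h3

end IsOrbitalMeasure

theorem continuous_pin (t₀ : Circ) :
    Continuous fun φ : CircleDiff 1 => CircleDiff.rot (-φ t₀) * φ :=
  (CircleDiff.continuous_rot.comp (CircleDiff.continuous_eval.comp
    (Continuous.prodMk_left t₀)).neg).mul continuous_id

theorem continuous_rot_mul :
    Continuous fun p : Circ × CircleDiff 1 => CircleDiff.rot p.1 * p.2 :=
  (CircleDiff.continuous_rot.comp continuous_fst).mul continuous_snd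

theorem pinnedMeasure_eq_map (μ : Measure (CircleDiff 1)) (t₀ : Circ) :
    pinnedMeasure μ t₀ = μ.map fun φ => CircleDiff.rot (-φ t₀) * φ := rfl

theorem ae_pinnedMeasure (μ : Measure (CircleDiff 1)) (t₀ : Circ) :
    ∀ᵐ φ ∂pinnedMeasure μ t₀, φ t₀ = 0 := by
  have hs : MeasurableSet {φ : CircleDiff 1 | φ t₀ = 0} :=
    (isClosed_eq (CircleDiff.continuous_eval.comp (Continuous.prodMk_left t₀))
      continuous_const).measurableSet
  rw [pinnedMeasure_eq_map, ae_map_iff (continuous_pin t₀).measurable.aemeasurable hs]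
  refine Eventually.of_forall fun φ => ?_
  rw [CircleDiff.mul_apply, CircleDiff.rot_apply, add_neg_cancel]

namespace IsOrbitalMeasure

variable {σ a : ℝ} {μ : Measure (CircleDiff 1)}

/-- On the right, the shift by `-φ t₀` is absorbed by invariance of Haar measure in `θ`; the
remaining rotation by `θ` is absorbed by invariance of `μ`, and the circle has total mass `1`. -/
theorem lintegral_eq_lintegral_pinned (hμ : IsOrbitalMeasure σ a μ) (t₀ : Circ)
    {h : CircleDiff 1 → ℝ≥0∞} (hh : Measurable h) :
    ∫⁻ φ, h φ ∂μ = ∫⁻ θ : Circ, ∫⁻ φ, h (CircleDiff.rot θ * φ) ∂pinnedMeasure μ t₀ := by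
  have := hμ.sigmaFinite
  have hm : Measurable fun p : Circ × CircleDiff 1 => h (CircleDiff.rot p.1 * p.2) :=
    hh.comp continuous_rot_mul.measurable
  have hm2 : Measurable fun p : Circ × CircleDiff 1 =>
      h (CircleDiff.rot p.1 * (CircleDiff.rot (-p.2 t₀) * p.2)) :=
    hm.comp (measurable_fst.prodMk ((continuous_pin t₀).measurable.comp measurable_snd))
  have h1 (θ : Circ) : ∫⁻ φ, h (CircleDiff.rot θ * φ) ∂pinnedMeasure μ t₀
      = ∫⁻ φ, h (CircleDiff.rot θ * (CircleDiff.rot (-φ t₀) * φ)) ∂μ := by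
    rw [pinnedMeasure_eq_map, lintegral_map (f := fun φ => h (CircleDiff.rot θ * φ))
      (hm.comp measurable_prodMk_left)
      (continuous_pin t₀).measurable]
  have h2 (θ : Circ) : ∫⁻ φ, h (CircleDiff.rot θ * φ) ∂μ = ∫⁻ φ, h φ ∂μ := by
    conv_rhs => rw [← hμ.map_rot_mul θ]
    rw [lintegral_map hh (continuous_const_mul _).measurable]
  have h3 (φ : CircleDiff 1) :
      ∫⁻ θ : Circ, h (CircleDiff.rot θ * (CircleDiff.rot (-φ t₀) * φ))
        = ∫⁻ θ : Circ, h (CircleDiff.rot θ * φ) := by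
    simp only [← mul_assoc, CircleDiff.rot_mul_rot]
    exact lintegral_add_left_eq_self (fun θ => h (CircleDiff.rot θ * φ)) (-φ t₀)
  simp only [h1]
  rw [lintegral_lintegral_swap hm2.aemeasurable]
  simp only [h3]
  rw [← lintegral_lintegral_swap hm.aemeasurable]
  simp only [h2]
  simp

/-- A pushforward need not be locally finite. Here, if rotating `V'` by the angles in an open arc
`I'` stays inside `U`, the disintegration gives `|I'| ν(V') ≤ μ(U)`, and `|I'| > 0`. -/
theorem isLocallyFiniteMeasure_pinned (hμ : IsOrbitalMeasure σ a μ) (t₀ : Circ) :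
    IsLocallyFiniteMeasure (pinnedMeasure μ t₀) := by
  have := hμ.locallyFinite
  refine ⟨fun φ₀ => ?_⟩
  obtain ⟨U, hφU, hU, hUf⟩ := μ.exists_isOpen_measure_lt_top φ₀
  have h1 : (fun p : Circ × CircleDiff 1 => CircleDiff.rot p.1 * p.2) ⁻¹' U
      ∈ 𝓝 ((0 : Circ), φ₀) := by
    refine continuous_rot_mul.continuousAt.preimage_mem_nhds (hU.mem_nhds ?_)
    rw [CircleDiff.rot_mul, show φ₀.addConst 0 = φ₀ from
      CircleDiff.ext_toFun fun t => add_zero _]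
    exact hφU
  obtain ⟨I, hI, V, hV, hIV⟩ := mem_nhds_prod_iff.1 h1
  obtain ⟨I', hI'I, hI', h0⟩ := mem_nhds_iff.1 hI
  obtain ⟨V', hV'V, hV', hφV⟩ := mem_nhds_iff.1 hV
  refine ⟨V', hV'.mem_nhds hφV, ?_⟩
  have h2 : volume I' * pinnedMeasure μ t₀ V' ≤ μ U := by
    calc volume I' * pinnedMeasure μ t₀ V'
        = ∫⁻ θ in I', pinnedMeasure μ t₀ V' := by rw [setLIntegral_const, mul_comm]
      _ ≤ ∫⁻ θ in I', ∫⁻ φ, U.indicator 1 (CircleDiff.rot θ * φ) ∂pinnedMeasure μ t₀ := by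
        refine setLIntegral_mono' hI'.measurableSet fun θ hθ => ?_
        rw [← lintegral_indicator_one hV'.measurableSet]
        refine lintegral_mono fun φ => ?_
        by_cases hφ : φ ∈ V'
        · have hm : CircleDiff.rot θ * φ ∈ U := hIV (mk_mem_prod (hI'I hθ) (hV'V hφ))
          rw [indicator_of_mem hφ, indicator_of_mem hm]
          simp
        · rw [indicator_of_notMem hφ]
          exact zero_le
      _ ≤ ∫⁻ θ : Circ, ∫⁻ φ, U.indicator 1 (CircleDiff.rot θ * φ) ∂pinnedMeasure μ t₀ :=
        setLIntegral_le_lintegral _ _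
      _ = μ U := by
        rw [← hμ.lintegral_eq_lintegral_pinned t₀ (measurable_one.indicator hU.measurableSet),
          lintegral_indicator_one hU.measurableSet]
  have h3 : volume I' ≠ 0 := (hI'.measure_pos volume ⟨0, h0⟩).ne'
  by_contra h4
  rw [not_lt, top_le_iff] at h4
  rw [h4, ENNReal.mul_top h3] at h2
  exact (h2.trans_lt hUf).ne rfl

/-- The change of variables formula for the pinned measure, averaged over the arc `(0, ε]`. -/
theorem lintegral_pinned_arc (hμ : IsOrbitalMeasure σ a μ) (t₀ : Circ) {F : ℝ → ℝ}
    (hF : IsCircleLift 3 F) (hF0 : F 0 = 0) {ψ : CircleDiff 3}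
    (hψ : ∀ x : ℝ, ψ (x : Circ) = (F x : Circ)) {ε : ℝ} (hε : ε ∈ Ioo (0 : ℝ) 1)
    {H : CircleDiff 1 → ℝ≥0∞} (hH : Measurable H) :
    ENNReal.ofReal (F ε) * ∫⁻ φ, H φ ∂pinnedMeasure μ t₀
      = ∫⁻ θ in Ioc 0 ε, ∫⁻ φ, ENNReal.ofReal (orbitalDensity σ a ψ (CircleDiff.rot θ * φ))
        * H (CircleDiff.rot (-ψ (θ : Circ)) * ψ.ofLE (by norm_num : 1 ≤ 3)
          * CircleDiff.rot θ * φ) ∂pinnedMeasure μ t₀ := by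
  have hF1 : F 1 = 1 := by simpa [hF0] using hF.add_one 0
  have hFε : F ε ≤ 1 := hF1 ▸ hF.strictMono.monotone hε.2.le
  have hFε0 : 0 < F ε := hF0 ▸ hF.strictMono hε.1
  -- The test function sees the rotation part `φ t₀` through the indicator `κ` of the arc `(0, F ε]`
  -- and the pinned part through `H`. Representatives are taken in `(0, 1]` to match the half-open
  -- arc.
  set κ : Circ → ℝ≥0∞ := fun x => (Iic (F ε)).indicator 1 (AddCircle.equivIoc (1 : ℝ) 0 x : ℝ)
  have hκ : Measurable κ := (measurable_one.indicator measurableSet_Iic).comp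
    (AddCircle.measurableEquivIoc (1 : ℝ) 0).measurable.subtype_val
  have hκ_coe {x : ℝ} (hx : x ∈ Ioc (0 : ℝ) 1) : κ (x : Circ) = (Iic (F ε)).indicator 1 x := by
    have : x ∈ Ioc (0 : ℝ) (0 + 1) := by simpa using hx
    simp only [κ, AddCircle.equivIoc_coe_of_mem this]
  have heval : Continuous fun φ : CircleDiff 1 => φ t₀ :=
    CircleDiff.continuous_eval.comp (Continuous.prodMk_left t₀)
  set h : CircleDiff 1 → ℝ≥0∞ := fun φ => H (CircleDiff.rot (-φ t₀) * φ) * κ (φ t₀)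
  have hh : Measurable h := (hH.comp (continuous_pin t₀).measurable).mul
    (hκ.comp heval.measurable)
  have hD : Measurable fun φ => ENNReal.ofReal (orbitalDensity σ a ψ φ) :=
    (continuous_orbitalDensity σ a ψ).measurable.ennreal_ofReal
  have h1 := hμ.lintegral_eq ψ hh
  rw [hμ.lintegral_eq_lintegral_pinned t₀ hh, hμ.lintegral_eq_lintegral_pinned t₀
    (h := fun φ => ENNReal.ofReal (orbitalDensity σ a ψ φ)
      * h (ψ.ofLE (by norm_num : 1 ≤ 3) * φ))
    (hD.mul (hh.comp (continuous_const_mul _).measurable))] at h1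
  -- For pinned `φ`, the value of `rot θ * φ` at `t₀` is `θ`, and pinning it again returns `φ`.
  have h2 (θ : Circ) : ∫⁻ φ, h (CircleDiff.rot θ * φ) ∂pinnedMeasure μ t₀
      = κ θ * ∫⁻ φ, H φ ∂pinnedMeasure μ t₀ := by
    rw [← lintegral_const_mul _ hH]
    refine lintegral_congr_ae ?_
    filter_upwards [ae_pinnedMeasure μ t₀] with φ hφ
    simp only [h, CircleDiff.mul_apply, CircleDiff.rot_apply, hφ, zero_add, ← mul_assoc,
      CircleDiff.rot_mul_rot, add_neg_cancel]
    rw [mul_comm, show CircleDiff.rot 0 * φ = φ from CircleDiff.ext_toFun fun t => add_zero _]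
  -- For pinned `φ`, the value of `ψ * rot θ * φ` at `t₀` is `ψ θ`, independent of `φ`, so `κ (ψ θ)`
  -- leaves the inner integral.
  have h3 (θ : Circ) : ∫⁻ φ, ENNReal.ofReal (orbitalDensity σ a ψ (CircleDiff.rot θ * φ))
        * h (ψ.ofLE (by norm_num : 1 ≤ 3) * (CircleDiff.rot θ * φ)) ∂pinnedMeasure μ t₀
      = κ (ψ θ) * ∫⁻ φ, ENNReal.ofReal (orbitalDensity σ a ψ (CircleDiff.rot θ * φ))
        * H (CircleDiff.rot (-ψ θ) * ψ.ofLE (by norm_num : 1 ≤ 3)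
          * CircleDiff.rot θ * φ) ∂pinnedMeasure μ t₀ := by
    have hm : Measurable fun φ => ENNReal.ofReal (orbitalDensity σ a ψ (CircleDiff.rot θ * φ))
        * H (CircleDiff.rot (-ψ θ) * ψ.ofLE (by norm_num : 1 ≤ 3) * CircleDiff.rot θ * φ) :=
      (hD.comp (continuous_const_mul _).measurable).mul
        (hH.comp (continuous_const_mul _).measurable)
    rw [← lintegral_const_mul _ hm]
    refine lintegral_congr_ae ?_
    filter_upwards [ae_pinnedMeasure μ t₀] with φ hφ
    have h4 : (ψ.ofLE (by norm_num : 1 ≤ 3) * (CircleDiff.rot θ * φ)) t₀ = ψ θ := by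
      change ψ (φ t₀ + θ) = _
      rw [hφ, zero_add]
    simp only [h, h4, mul_assoc]
    rw [mul_comm (H _), mul_left_comm]
  simp only [h2, h3] at h1
  rw [lintegral_mul_const _ hκ] at h1
  rw [← AddCircle.lintegral_preimage 1 0, ← AddCircle.lintegral_preimage 1 0] at h1
  simp only [zero_add] at h1
  have h5 : ∫⁻ x in Ioc (0 : ℝ) 1, κ (x : Circ) = ENNReal.ofReal (F ε) := by
    rw [setLIntegral_congr_fun measurableSet_Ioc fun x hx => hκ_coe hx,
      lintegral_indicator_one measurableSet_Iic, Measure.restrict_apply measurableSet_Iic,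
      inter_comm, Ioc_inter_Iic, min_eq_right hFε, Real.volume_Ioc, sub_zero]
  rw [h5] at h1
  rw [h1, ← inter_eq_left.2 (Ioc_subset_Ioc_right hε.2.le : Ioc 0 ε ⊆ Ioc 0 1),
    ← setLIntegral_indicator measurableSet_Ioc]
  refine setLIntegral_congr_fun measurableSet_Ioc fun x hx => ?_
  -- As `F` increases from `0` to `1` on `[0,1]`, the indicator of `(0, F ε]` composed with `F` is
  -- the indicator of `(0, ε]`.
  have hFx : F x ∈ Ioc (0 : ℝ) 1 :=
    ⟨hF0 ▸ hF.strictMono hx.1, hF1 ▸ hF.strictMono.monotone hx.2⟩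
  have h6 : κ (ψ (x : Circ)) = (Iic (F ε)).indicator 1 (F x) := by rw [hψ, hκ_coe hFx]
  simp only [h6]
  by_cases hxε : x ≤ ε
  · rw [indicator_of_mem (s := Iic (F ε)) (hF.strictMono.le_iff_le.2 hxε),
      indicator_of_mem (s := Ioc 0 ε) ⟨hx.1, hxε⟩, Pi.one_apply, one_mul]
  · rw [indicator_of_notMem (s := Iic (F ε)) (fun h => hxε (hF.strictMono.le_iff_le.1 h)),
      indicator_of_notMem (s := Ioc 0 ε) (fun h => hxε h.2), zero_mul]

end IsOrbitalMeasure

/-! ### Circle diffeomorphisms with prescribed derivative of the logarithmic derivative -/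

theorem hasDerivAt_primitive {v : ℝ → ℝ} (hv : Continuous v) (x : ℝ) :
    HasDerivAt (fun x => ∫ y in 0..x, v y) (v x) x :=
  intervalIntegral.integral_hasDerivAt_right (hv.intervalIntegrable _ _)
    hv.stronglyMeasurable.stronglyMeasurableAtFilter hv.continuousAt

theorem deriv_primitive {v : ℝ → ℝ} (hv : Continuous v) :
    deriv (fun x => ∫ y in 0..x, v y) = v :=
  funext fun x => (hasDerivAt_primitive hv x).deriv

theorem contDiff_primitive {v : ℝ → ℝ} {n : ℕ} (hv : ContDiff ℝ n v) :
    ContDiff ℝ (n + 1) (fun x => ∫ y in 0..x, v y) := by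
  rw [contDiff_succ_iff_deriv, deriv_primitive hv.continuous]
  exact ⟨fun x => (hasDerivAt_primitive hv.continuous x).differentiableAt, by simp, hv⟩

theorem periodic_primitive {v : ℝ → ℝ} (hv : Continuous v) (hp : Function.Periodic v 1)
    (h0 : ∫ y in 0..1, v y = 0) : Function.Periodic (fun x => ∫ y in 0..x, v y) 1 := by
  intro x
  have := hp.intervalIntegral_add_eq_add 0 x fun _ _ => hv.intervalIntegrable _ _
  simp only [zero_add, h0, add_zero] at this
  exact this

/-- The primitive of `v` that has mean `0` over `[0, 1]`. -/
noncomputable def meanZeroPrimitive (v : ℝ → ℝ) (x : ℝ) : ℝ :=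
  (∫ y in 0..x, v y) - ∫ z in 0..1, ∫ y in 0..z, v y

/-- The logarithm of the derivative, up to a constant. -/
noncomputable def logDerivPrimitive (v : ℝ → ℝ) (x : ℝ) : ℝ := ∫ y in 0..x, meanZeroPrimitive v y

/-- The lift `F` with `F 0 = 0` and `(F'' / F')' = v`. -/
noncomputable def liftOfLogDeriv (v : ℝ → ℝ) (x : ℝ) : ℝ :=
  (∫ y in 0..1, Real.exp (logDerivPrimitive v y))⁻¹ *
    ∫ y in 0..x, Real.exp (logDerivPrimitive v y)

section LiftOfLogDeriv

variable {v : ℝ → ℝ}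

theorem contDiff_meanZeroPrimitive (hv : Continuous v) : ContDiff ℝ 1 (meanZeroPrimitive v) := by
  have := contDiff_primitive (n := 0) (v := v) (by simpa using hv)
  exact ContDiff.sub (by simpa using this) contDiff_const

theorem integral_meanZeroPrimitive (hv : Continuous v) :
    ∫ y in 0..1, meanZeroPrimitive v y = 0 := by
  have h : Continuous fun x => ∫ y in 0..x, v y :=
    continuous_iff_continuousAt.2 fun x => (hasDerivAt_primitive hv x).continuousAt
  simp only [meanZeroPrimitive]
  rw [intervalIntegral.integral_sub (h.intervalIntegrable _ _) (by simp)]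
  simp

theorem periodic_meanZeroPrimitive (hv : Continuous v) (hp : Function.Periodic v 1)
    (h0 : ∫ y in 0..1, v y = 0) : Function.Periodic (meanZeroPrimitive v) 1 := fun x =>
  congrArg (· - _) (periodic_primitive hv hp h0 x)

theorem deriv_meanZeroPrimitive (hv : Continuous v) : deriv (meanZeroPrimitive v) = v := by
  funext x
  exact ((hasDerivAt_primitive hv x).sub_const _).deriv

theorem contDiff_logDerivPrimitive (hv : Continuous v) : ContDiff ℝ 2 (logDerivPrimitive v) := by
  have := contDiff_primitive (n := 1) (by simpa using contDiff_meanZeroPrimitive hv)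
  exact this.of_le (by norm_num)

theorem periodic_logDerivPrimitive (hv : Continuous v) (hp : Function.Periodic v 1)
    (h0 : ∫ y in 0..1, v y = 0) : Function.Periodic (logDerivPrimitive v) 1 :=
  periodic_primitive (contDiff_meanZeroPrimitive hv).continuous
    (periodic_meanZeroPrimitive hv hp h0) (integral_meanZeroPrimitive hv)

theorem integral_exp_logDerivPrimitive_pos (hv : Continuous v) :
    0 < ∫ y in 0..1, Real.exp (logDerivPrimitive v y) :=
  intervalIntegral.intervalIntegral_pos_of_pos
    ((Real.continuous_exp.comp (contDiff_logDerivPrimitive hv).continuous).intervalIntegrable _ _)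
    (fun _ => Real.exp_pos _) one_pos

theorem deriv_liftOfLogDeriv (hv : Continuous v) :
    deriv (liftOfLogDeriv v) = fun x => (∫ y in 0..1, Real.exp (logDerivPrimitive v y))⁻¹ *
      Real.exp (logDerivPrimitive v x) :=
  funext fun x => ((hasDerivAt_primitive (Real.continuous_exp.comp
    (contDiff_logDerivPrimitive hv).continuous) x).const_mul _).deriv

theorem liftOfLogDeriv_zero (v : ℝ → ℝ) : liftOfLogDeriv v 0 = 0 := by simp [liftOfLogDeriv]

/-- Two periodicity conditions have to hold: zero mean of `v` makes `F''/F'` periodic, and the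
mean-zero choice of its primitive makes `log F'` periodic. The normalizing constant then gives
increment `1` over a period. -/
theorem isCircleLift_liftOfLogDeriv (hv : Continuous v) (hp : Function.Periodic v 1)
    (h0 : ∫ y in 0..1, v y = 0) : IsCircleLift 3 (liftOfLogDeriv v) where
  contDiff := by
    have := contDiff_primitive (n := 2) (contDiff_logDerivPrimitive hv).exp
    exact ContDiff.mul contDiff_const (this.of_le (by norm_num))
  deriv_pos x := by
    rw [deriv_liftOfLogDeriv hv]
    exact mul_pos (inv_pos.2 (integral_exp_logDerivPrimitive_pos hv)) (Real.exp_pos _)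
  add_one x := by
    have h1 : Continuous fun x => Real.exp (logDerivPrimitive v x) :=
      (contDiff_logDerivPrimitive hv).exp.continuous
    have h2 : Function.Periodic (fun x => Real.exp (logDerivPrimitive v x)) 1 := fun x => by
      simp only [periodic_logDerivPrimitive hv hp h0 x]
    have h3 := h2.intervalIntegral_add_eq_add 0 x fun _ _ => h1.intervalIntegrable _ _
    simp only [zero_add] at h3
    rw [liftOfLogDeriv, h3, mul_add, inv_mul_cancel₀ (integral_exp_logDerivPrimitive_pos hv).ne']
    rfl

/-- `F''/F'` is `meanZeroPrimitive v`, because the normalizing constant cancels in the quotient. -/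
theorem schwarzianWithin_liftOfLogDeriv (hv : Continuous v) (x : ℝ) :
    schwarzianWithin univ (liftOfLogDeriv v) x = v x - 1 / 2 * meanZeroPrimitive v x ^ 2 := by
  have h1 (x : ℝ) : HasDerivAt (logDerivPrimitive v) (meanZeroPrimitive v x) x :=
    hasDerivAt_primitive (contDiff_meanZeroPrimitive hv).continuous x
  have hc := (integral_exp_logDerivPrimitive_pos hv).ne'
  have h2 : (fun y => deriv (deriv (liftOfLogDeriv v)) y / deriv (liftOfLogDeriv v) y)
      = meanZeroPrimitive v := by
    rw [deriv_liftOfLogDeriv hv]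
    funext y
    rw [((h1 y).exp.const_mul _).deriv]
    field_simp
  have h3 : deriv (deriv (liftOfLogDeriv v)) x / deriv (liftOfLogDeriv v) x
      = meanZeroPrimitive v x := congrFun h2 x
  simp only [schwarzianWithin_univ, h2, h3, deriv_meanZeroPrimitive hv]

end LiftOfLogDeriv

/-! ### Smoothing of a kink -/

/-- The hat function with value `1` at `0` that vanishes on `[δ, ∞)`. -/
noncomputable def hat (δ x : ℝ) : ℝ := max 0 (1 - x / δ)

theorem continuous_hat (δ : ℝ) : Continuous (hat δ) := by unfold hat; fun_prop

theorem hat_nonneg (δ x : ℝ) : 0 ≤ hat δ x := le_max_left _ _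

theorem hat_zero (δ : ℝ) : hat δ 0 = 1 := by simp [hat]

theorem hat_eq_zero {δ x : ℝ} (hδ : 0 < δ) (hx : δ ≤ x) : hat δ x = 0 :=
  max_eq_left (by rw [sub_nonpos, one_le_div hδ]; exact hx)

theorem hat_le_one {δ x : ℝ} (hδ : 0 < δ) (hx : 0 ≤ x) : hat δ x ≤ 1 :=
  max_le zero_le_one (by have := div_nonneg hx hδ.le; linarith)

theorem integral_hat {δ x : ℝ} (hδ : 0 < δ) (hx : δ ≤ x) : ∫ y in 0..x, hat δ y = δ / 2 := by
  have hi (a b : ℝ) : IntervalIntegrable (hat δ) volume a b :=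
    (continuous_hat δ).intervalIntegrable a b
  rw [← intervalIntegral.integral_add_adjacent_intervals (hi 0 δ) (hi δ x)]
  have h1 : ∫ y in δ..x, hat δ y = 0 := by
    rw [intervalIntegral.integral_congr (g := fun _ => 0)]
    · simp
    · intro y hy
      rw [uIcc_of_le hx] at hy
      exact hat_eq_zero hδ hy.1
  have h2 : ∫ y in 0..δ, hat δ y = ∫ y in 0..δ, (1 - y / δ) := by
    refine intervalIntegral.integral_congr fun y hy => ?_
    rw [uIcc_of_le hδ.le] at hy
    exact max_eq_right (by have := (div_le_one hδ).2 hy.2; linarith)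
  rw [h1, h2, intervalIntegral.integral_sub (by simp) (Continuous.intervalIntegrable
    (by fun_prop) _ _), intervalIntegral.integral_div, integral_id]
  field_simp
  simp
  ring

theorem integral_hat_one_sub {δ x : ℝ} (hδ : 0 < δ) (hx0 : 0 ≤ x) (hx : x ≤ 1 - δ) :
    ∫ y in 0..x, hat δ (1 - y) = 0 := by
  rw [intervalIntegral.integral_congr (g := fun _ => 0)]
  · simp
  · intro y hy
    rw [uIcc_of_le hx0] at hy
    exact hat_eq_zero hδ (by linarith [hy.2])

theorem integral_hat_one_sub_one {δ : ℝ} (hδ : 0 < δ) (hδ1 : δ ≤ 1) :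
    ∫ y in 0..1, hat δ (1 - y) = δ / 2 := by
  rw [intervalIntegral.integral_comp_sub_left (hat δ) 1, sub_self, sub_zero, integral_hat hδ hδ1]

/-! ### Periodic bumps and matching of endpoint values -/

theorem apply_fract_of_mem_Icc {X : Type*} {f : ℝ → X} (h : f 0 = f 1) {x : ℝ}
    (hx : x ∈ Icc (0 : ℝ) 1) : f (Int.fract x) = f x := by
  rcases hx.2.lt_or_eq with h1 | rfl
  · rw [Int.fract_eq_self.2 ⟨hx.1, h1⟩]
  · rw [Int.fract_one, h]

theorem periodic_comp_fract {X : Type*} (f : ℝ → X) :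
    Function.Periodic (fun x => f (Int.fract x)) 1 := fun x => by simp

/-- A periodic bump of mass `1` around the integers. -/
noncomputable def bump (δ x : ℝ) : ℝ :=
  δ⁻¹ * (hat δ (Int.fract x) + hat δ (1 - Int.fract x))

/-- A continuous periodic function that agrees with `w₁` on `[δ, 1 - δ]`. -/
noncomputable def endpointMatch (w₁ : ℝ → ℝ) (δ x : ℝ) : ℝ :=
  w₁ (Int.fract x) + (w₁ 1 - w₁ 0) / 2 * (hat δ (Int.fract x) - hat δ (1 - Int.fract x))

section Bump

variable {δ : ℝ}

theorem bump_of_mem {x : ℝ} (hx : x ∈ Icc (0 : ℝ) 1) :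
    bump δ x = δ⁻¹ * (hat δ x + hat δ (1 - x)) :=
  apply_fract_of_mem_Icc (f := fun x => δ⁻¹ * (hat δ x + hat δ (1 - x)))
    (by simp only [sub_zero, sub_self]; ring) hx

theorem continuous_bump (δ : ℝ) : Continuous (bump δ) := by
  have h := continuous_hat δ
  exact ContinuousOn.comp_fract'' (f := fun x => δ⁻¹ * (hat δ x + hat δ (1 - x)))
    (Continuous.continuousOn (by fun_prop)) (by simp only [sub_zero, sub_self]; ring)

theorem periodic_bump (δ : ℝ) : Function.Periodic (bump δ) 1 :=
  periodic_comp_fract fun x => δ⁻¹ * (hat δ x + hat δ (1 - x))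

theorem bump_nonneg (hδ : 0 < δ) (x : ℝ) : 0 ≤ bump δ x :=
  mul_nonneg (inv_nonneg.2 hδ.le) (add_nonneg (hat_nonneg _ _) (hat_nonneg _ _))

theorem bump_eq_zero (hδ : 0 < δ) {x : ℝ} (hx : Int.fract x ∈ Icc δ (1 - δ)) : bump δ x = 0 := by
  rw [bump, hat_eq_zero hδ hx.1, hat_eq_zero hδ (by linarith [hx.2])]
  simp

theorem integral_bump_eq {x : ℝ} (hx : x ∈ Icc (0 : ℝ) 1) :
    ∫ y in 0..x, bump δ y
      = δ⁻¹ * ((∫ y in 0..x, hat δ y) + ∫ y in 0..x, hat δ (1 - y)) := by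
  have h := continuous_hat δ
  have h' : Continuous fun y => hat δ (1 - y) := by fun_prop
  rw [← intervalIntegral.integral_add (h.intervalIntegrable _ _)
    (h'.intervalIntegrable _ _),
    ← intervalIntegral.integral_const_mul]
  refine intervalIntegral.integral_congr fun y hy => ?_
  rw [uIcc_of_le hx.1] at hy
  exact bump_of_mem ⟨hy.1, hy.2.trans hx.2⟩

theorem integral_bump (hδ : 0 < δ) (hδ1 : δ ≤ 1) : ∫ y in 0..1, bump δ y = 1 := by
  rw [integral_bump_eq (by simp), integral_hat hδ hδ1, integral_hat_one_sub_one hδ hδ1]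
  field_simp
  norm_num

theorem integral_bump_of_mem (hδ : 0 < δ) {x : ℝ} (hx : x ∈ Icc δ (1 - δ)) :
    ∫ y in 0..x, bump δ y = 1 / 2 := by
  rw [integral_bump_eq ⟨hδ.le.trans hx.1, by linarith [hx.2]⟩, integral_hat hδ hx.1,
    integral_hat_one_sub hδ (hδ.le.trans hx.1) hx.2]
  field_simp
  norm_num

theorem integral_bump_mem_Icc (hδ : 0 < δ) (hδ1 : δ ≤ 1) {x : ℝ} (hx : x ∈ Icc (0 : ℝ) 1) :
    ∫ y in 0..x, bump δ y ∈ Icc (0 : ℝ) 1 := by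
  refine ⟨intervalIntegral.integral_nonneg hx.1 fun y _ => bump_nonneg hδ y, ?_⟩
  rw [← integral_bump hδ hδ1]
  exact intervalIntegral.integral_mono_interval le_rfl hx.1 hx.2
    (Eventually.of_forall fun y => bump_nonneg hδ y)
    ((continuous_bump δ).intervalIntegrable _ _)

variable {w₁ : ℝ → ℝ}

/-- The two hats move both end values to the average of `w₁ 0` and `w₁ 1`. -/
theorem endpointMatch_ends (hδ : 0 < δ) (hδ1 : δ ≤ 1) :
    w₁ 0 + (w₁ 1 - w₁ 0) / 2 * (hat δ 0 - hat δ (1 - 0))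
      = w₁ 1 + (w₁ 1 - w₁ 0) / 2 * (hat δ 1 - hat δ (1 - 1)) := by
  rw [sub_zero, sub_self, hat_zero, hat_eq_zero hδ hδ1]
  ring

theorem endpointMatch_of_mem (hδ : 0 < δ) (hδ1 : δ ≤ 1) {x : ℝ} (hx : x ∈ Icc (0 : ℝ) 1) :
    endpointMatch w₁ δ x = w₁ x + (w₁ 1 - w₁ 0) / 2 * (hat δ x - hat δ (1 - x)) :=
  apply_fract_of_mem_Icc (f := fun x => w₁ x + (w₁ 1 - w₁ 0) / 2 * (hat δ x - hat δ (1 - x)))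
    (endpointMatch_ends hδ hδ1) hx

theorem continuous_endpointMatch (hw : ContinuousOn w₁ (Icc 0 1)) (hδ : 0 < δ) (hδ1 : δ ≤ 1) :
    Continuous (endpointMatch w₁ δ) := by
  have h := continuous_hat δ
  exact ContinuousOn.comp_fract''
    (f := fun x => w₁ x + (w₁ 1 - w₁ 0) / 2 * (hat δ x - hat δ (1 - x)))
    (hw.add (Continuous.continuousOn (by fun_prop))) (endpointMatch_ends hδ hδ1)

theorem periodic_endpointMatch (w₁ : ℝ → ℝ) (δ : ℝ) : Function.Periodic (endpointMatch w₁ δ) 1 :=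
  periodic_comp_fract fun x => w₁ x + (w₁ 1 - w₁ 0) / 2 * (hat δ x - hat δ (1 - x))

theorem endpointMatch_eq (hδ : 0 < δ) {x : ℝ} (hx : Int.fract x ∈ Icc δ (1 - δ)) :
    endpointMatch w₁ δ x = w₁ (Int.fract x) := by
  rw [endpointMatch, hat_eq_zero hδ hx.1, hat_eq_zero hδ (by linarith [hx.2])]
  simp

theorem abs_hat_sub_hat_le (hδ : 0 < δ) {x : ℝ} (hx : x ∈ Icc (0 : ℝ) 1) :
    |hat δ x - hat δ (1 - x)| ≤ 1 := by
  have h1 := hat_le_one hδ hx.1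
  have h2 := hat_le_one hδ (sub_nonneg.2 hx.2)
  have h3 := hat_nonneg δ x
  have h4 := hat_nonneg δ (1 - x)
  rw [abs_le]
  constructor <;> linarith

theorem abs_endpointMatch_le (hδ : 0 < δ) {M : ℝ} (hM : ∀ x ∈ Icc (0 : ℝ) 1, |w₁ x| ≤ M) (x : ℝ) :
    |endpointMatch w₁ δ x| ≤ 2 * M := by
  have hx : Int.fract x ∈ Icc (0 : ℝ) 1 := ⟨Int.fract_nonneg x, (Int.fract_lt_one x).le⟩
  have h1 := hM _ hx
  have h2 := hM 1 (by simp)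
  have h3 := hM 0 (by simp)
  have h4 : |(w₁ 1 - w₁ 0) / 2| ≤ M := by
    rw [abs_le] at *
    constructor <;> linarith
  have h5 : |(w₁ 1 - w₁ 0) / 2 * (hat δ (Int.fract x) - hat δ (1 - Int.fract x))| ≤ M * 1 := by
    rw [abs_mul]
    exact mul_le_mul h4 (abs_hat_sub_hat_le hδ hx) (abs_nonneg _) ((abs_nonneg _).trans h4)
  calc _ ≤ _ := abs_add_le _ _
    _ ≤ 2 * M := by linarith

/-- The difference between a primitive of the smoothed kink and the primitive of the kink. -/
theorem integral_endpointMatch_add_bump {w : ℝ → ℝ} (hδ : 0 < δ) (hδ1 : δ ≤ 1)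
    (hw : ContinuousOn w₁ (Icc 0 1))
    (hint : ∀ x ∈ Icc (0 : ℝ) 1, w x = w 0 + ∫ y in 0..x, w₁ y) {x : ℝ}
    (hx : x ∈ Icc (0 : ℝ) 1) (J : ℝ) :
    ∫ y in 0..x, (endpointMatch w₁ δ y + J * bump δ y) = w x - w 0
      + (w₁ 1 - w₁ 0) / 2 * ((∫ y in 0..x, hat δ y) - ∫ y in 0..x, hat δ (1 - y))
      + J * ∫ y in 0..x, bump δ y := by
  have h := continuous_hat δ
  have h' : Continuous fun y => hat δ (1 - y) := by fun_prop
  have hi1 : IntervalIntegrable w₁ volume 0 x := by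
    refine (hw.mono ?_).intervalIntegrable
    rw [uIcc_of_le hx.1]
    exact Icc_subset_Icc_right hx.2
  rw [intervalIntegral.integral_add ((continuous_endpointMatch hw hδ hδ1).intervalIntegrable _ _)
    (((continuous_bump δ).const_mul J).intervalIntegrable _ _),
    intervalIntegral.integral_const_mul]
  congr 1
  rw [hint x hx, ← intervalIntegral.integral_sub (h.intervalIntegrable _ _)
    (h'.intervalIntegrable _ _),
    ← intervalIntegral.integral_const_mul, add_sub_cancel_left,
    ← intervalIntegral.integral_add hi1 (Continuous.intervalIntegrable (by fun_prop) _ _)]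
  refine intervalIntegral.integral_congr fun y hy => ?_
  rw [uIcc_of_le hx.1] at hy
  exact endpointMatch_of_mem hδ hδ1 ⟨hy.1, hy.2.trans hx.2⟩

end Bump

/-- `w` is continuously differentiable on `[0, 1]` with derivative `w₁` and has mean `0`; it is
the logarithmic derivative of `g'` for a diffeomorphism `g` with `g' 0 = g' 1`. -/
structure IsKinkData (w w₁ : ℝ → ℝ) : Prop where
  continuousOn : ContinuousOn w (Icc 0 1)
  continuousOn_deriv : ContinuousOn w₁ (Icc 0 1)
  eq_integral : ∀ x ∈ Icc (0 : ℝ) 1, w x = w 0 + ∫ y in 0..x, w₁ y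
  integral_eq_zero : ∫ y in 0..1, w y = 0

/-- The second derivative of the logarithm of the derivative of the smoothed diffeomorphism. -/
noncomputable def smoothed (w w₁ : ℝ → ℝ) (δ x : ℝ) : ℝ :=
  endpointMatch w₁ δ x + (w 0 - w 1) * bump δ x

/-- The two boundary layers have length `δ` and contribute at most `C * δ` each; the middle
contributes at most `C * δ` because its length is at most `1`. -/
theorem integral_abs_le_of_le_ends {e : ℝ → ℝ} {δ C : ℝ} (hδ : 0 < δ) (hδ1 : δ ≤ 1 / 2)
    (hC : 0 ≤ C) (he : ContinuousOn e (Icc 0 1)) (h1 : ∀ x ∈ Icc (0 : ℝ) 1, |e x| ≤ C)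
    (h2 : ∀ x ∈ Icc δ (1 - δ), |e x| ≤ C * δ) : ∫ y in 0..1, |e y| ≤ 3 * C * δ := by
  have hi {a b : ℝ} (ha : 0 ≤ a) (hab : a ≤ b) (hb : b ≤ 1) :
      IntervalIntegrable (fun y => |e y|) volume a b := by
    refine (he.abs.mono ?_).intervalIntegrable
    rw [uIcc_of_le hab]
    exact Icc_subset_Icc ha hb
  have hb {a b K : ℝ} (hab : a ≤ b) (hK : ∀ x ∈ Icc a b, |e x| ≤ K) :
      ∫ y in a..b, |e y| ≤ K * (b - a) := by
    have := intervalIntegral.norm_integral_le_of_norm_le_const (a := a) (b := b)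
      (f := fun y => |e y|) (C := K) fun x hx => by
        rw [uIoc_of_le hab] at hx
        simpa using hK x ⟨hx.1.le, hx.2⟩
    rw [abs_of_nonneg (sub_nonneg.2 hab)] at this
    exact (le_abs_self _).trans this
  rw [← intervalIntegral.integral_add_adjacent_intervals (b := 1 - δ)
    (hi le_rfl (by linarith) (by linarith)) (hi (by linarith) (by linarith) le_rfl),
    ← intervalIntegral.integral_add_adjacent_intervals (b := δ)
    (hi le_rfl hδ.le (by linarith)) (hi hδ.le (by linarith) (by linarith))]
  have e1 := hb hδ.le (K := C) fun x hx => h1 x ⟨hx.1, by linarith [hx.2]⟩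
  have e2 := hb (by linarith : δ ≤ 1 - δ) h2
  have e3 := hb (by linarith : 1 - δ ≤ 1) (K := C) fun x hx => h1 x ⟨by linarith [hx.1], hx.2⟩
  have e4 : C * δ * (1 - δ - δ) ≤ C * δ := by
    have := mul_nonneg hC hδ.le
    nlinarith
  linarith

namespace IsKinkData

variable {w w₁ : ℝ → ℝ} {δ : ℝ}

theorem continuous_smoothed (h : IsKinkData w w₁) (hδ : 0 < δ) (hδ1 : δ ≤ 1 / 2) :
    Continuous (smoothed w w₁ δ) :=
  (continuous_endpointMatch h.continuousOn_deriv hδ (by linarith)).add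
    ((continuous_bump δ).const_mul _)

theorem periodic_smoothed (w w₁ : ℝ → ℝ) (δ : ℝ) : Function.Periodic (smoothed w w₁ δ) 1 :=
  fun x => by simp only [smoothed, periodic_endpointMatch w₁ δ x, periodic_bump δ x]

theorem integral_smoothed_eq (h : IsKinkData w w₁) (hδ : 0 < δ) (hδ1 : δ ≤ 1 / 2) {x : ℝ}
    (hx : x ∈ Icc (0 : ℝ) 1) :
    ∫ y in 0..x, smoothed w w₁ δ y = w x - w 0
      + (w₁ 1 - w₁ 0) / 2 * ((∫ y in 0..x, hat δ y) - ∫ y in 0..x, hat δ (1 - y))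
      + (w 0 - w 1) * ∫ y in 0..x, bump δ y :=
  integral_endpointMatch_add_bump hδ (by linarith) h.continuousOn_deriv h.eq_integral hx _

/-- The unit mass of the bump, times `w 0 - w 1`, cancels the increment of `w`; the two hats have
equal integrals and cancel each other. -/
theorem integral_smoothed (h : IsKinkData w w₁) (hδ : 0 < δ) (hδ1 : δ ≤ 1 / 2) :
    ∫ y in 0..1, smoothed w w₁ δ y = 0 := by
  rw [h.integral_smoothed_eq hδ hδ1 (by simp), integral_hat hδ (by linarith),
    integral_hat_one_sub_one hδ (by linarith), integral_bump hδ (by linarith)]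
  ring

/-- The error of the smoothed primitive. -/
theorem abs_integral_smoothed_sub_le (h : IsKinkData w w₁) (hδ : 0 < δ) (hδ1 : δ ≤ 1 / 2) {x : ℝ}
    (hx : x ∈ Icc (0 : ℝ) 1) :
    |(∫ y in 0..x, smoothed w w₁ δ y) - (w x - w 0 + (w 0 - w 1) / 2)|
      ≤ |w₁ 1 - w₁ 0| + |w 0 - w 1| := by
  have hc := continuous_hat δ
  have hc' : Continuous fun y => hat δ (1 - y) := by fun_prop
  have h1 : |(∫ y in 0..x, hat δ y) - ∫ y in 0..x, hat δ (1 - y)| ≤ 1 := by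
    rw [← intervalIntegral.integral_sub (hc.intervalIntegrable _ _) (hc'.intervalIntegrable _ _)]
    have := intervalIntegral.norm_integral_le_of_norm_le_const (a := 0) (b := x)
      (f := fun y => hat δ y - hat δ (1 - y)) (C := 1) fun y hy => by
        rw [uIoc_of_le hx.1] at hy
        exact abs_hat_sub_hat_le hδ ⟨hy.1.le, hy.2.trans hx.2⟩
    rw [sub_zero, abs_of_nonneg hx.1, one_mul] at this
    exact this.trans hx.2
  have h2 := integral_bump_mem_Icc hδ (by linarith) hx
  have h3 : |(∫ y in 0..x, bump δ y) - 1 / 2| ≤ 1 := by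
    rw [abs_le]
    constructor <;> linarith [h2.1, h2.2]
  rw [h.integral_smoothed_eq hδ hδ1 hx]
  calc _ = |(w₁ 1 - w₁ 0) / 2 * ((∫ y in 0..x, hat δ y) - ∫ y in 0..x, hat δ (1 - y))
        + (w 0 - w 1) * ((∫ y in 0..x, bump δ y) - 1 / 2)| := by congr 1; ring
    _ ≤ |(w₁ 1 - w₁ 0) / 2| * 1 + |w 0 - w 1| * 1 := by
      refine (abs_add_le _ _).trans ?_
      rw [abs_mul, abs_mul]
      gcongr
    _ ≤ _ := by
      rw [abs_div, abs_two]
      linarith [abs_nonneg (w₁ 1 - w₁ 0)]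

/-- Outside the boundary layers exactly half of the bump has been collected, and the only error is
`(w₁ 1 - w₁ 0) * δ / 4`, left by the first hat. -/
theorem abs_integral_smoothed_sub_le_mul (h : IsKinkData w w₁) (hδ : 0 < δ) (hδ1 : δ ≤ 1 / 2)
    {x : ℝ} (hx : x ∈ Icc δ (1 - δ)) :
    |(∫ y in 0..x, smoothed w w₁ δ y) - (w x - w 0 + (w 0 - w 1) / 2)|
      ≤ (|w₁ 1 - w₁ 0| + |w 0 - w 1|) * δ := by
  have hx0 : 0 ≤ x := hδ.le.trans hx.1
  rw [h.integral_smoothed_eq hδ hδ1 ⟨hx0, by linarith [hx.2]⟩,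
    integral_bump_of_mem hδ hx, integral_hat hδ hx.1,
    integral_hat_one_sub hδ hx0 hx.2]
  calc _ = |(w₁ 1 - w₁ 0) * (δ / 4)| := by congr 1; ring
    _ = |w₁ 1 - w₁ 0| * (δ / 4) := by rw [abs_mul, abs_of_pos (by linarith : 0 < δ / 4)]
    _ ≤ _ := by nlinarith [abs_nonneg (w₁ 1 - w₁ 0), abs_nonneg (w 0 - w 1)]

theorem continuous_integral_smoothed (h : IsKinkData w w₁) (hδ : 0 < δ) (hδ1 : δ ≤ 1 / 2) :
    Continuous fun x => ∫ y in 0..x, smoothed w w₁ δ y :=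
  continuous_iff_continuousAt.2 fun x =>
    (hasDerivAt_primitive (h.continuous_smoothed hδ hδ1) x).continuousAt

/-- Both `w` and its approximation have mean zero, so the additive constant in the primitive
disappears once the mean of the error is subtracted. -/
theorem meanZeroPrimitive_sub (h : IsKinkData w w₁) (hδ : 0 < δ) (hδ1 : δ ≤ 1 / 2) (x : ℝ) :
    meanZeroPrimitive (smoothed w w₁ δ) x - w x
      = ((∫ y in 0..x, smoothed w w₁ δ y) - (w x - w 0 + (w 0 - w 1) / 2))
        - ∫ z in 0..1, ((∫ y in 0..z, smoothed w w₁ δ y) - (w z - w 0 + (w 0 - w 1) / 2)) := by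
  have hc := h.continuous_integral_smoothed hδ hδ1
  have hw : IntervalIntegrable w volume 0 1 := by
    refine ContinuousOn.intervalIntegrable ?_
    rw [uIcc_of_le zero_le_one]
    exact h.continuousOn
  rw [intervalIntegral.integral_sub (hc.intervalIntegrable _ _)
    ((hw.sub (by simp)).add (by simp)),
    intervalIntegral.integral_add (hw.sub (by simp)) (by simp),
    intervalIntegral.integral_sub hw (by simp), h.integral_eq_zero, meanZeroPrimitive]
  simp
  ring

theorem abs_integral_error_le (h : IsKinkData w w₁) (hδ : 0 < δ) (hδ1 : δ ≤ 1 / 2) :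
    |∫ z in 0..1, ((∫ y in 0..z, smoothed w w₁ δ y) - (w z - w 0 + (w 0 - w 1) / 2))|
      ≤ 3 * (|w₁ 1 - w₁ 0| + |w 0 - w 1|) * δ :=
  (intervalIntegral.abs_integral_le_integral_abs zero_le_one).trans
    (integral_abs_le_of_le_ends hδ hδ1 (by positivity)
      ((h.continuous_integral_smoothed hδ hδ1).continuousOn.sub
        ((h.continuousOn.sub continuousOn_const).add continuousOn_const))
      (fun _ hx => h.abs_integral_smoothed_sub_le hδ hδ1 hx)
      fun _ hx => h.abs_integral_smoothed_sub_le_mul hδ hδ1 hx)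

theorem abs_meanZeroPrimitive_sub_le (h : IsKinkData w w₁) (hδ : 0 < δ) (hδ1 : δ ≤ 1 / 2) {x : ℝ}
    (hx : x ∈ Icc (0 : ℝ) 1) : |meanZeroPrimitive (smoothed w w₁ δ) x - w x|
      ≤ 4 * (|w₁ 1 - w₁ 0| + |w 0 - w 1|) := by
  rw [h.meanZeroPrimitive_sub hδ hδ1]
  have h1 := h.abs_integral_smoothed_sub_le hδ hδ1 hx
  have h2 := h.abs_integral_error_le hδ hδ1
  refine (abs_sub _ _).trans ?_
  nlinarith [abs_nonneg (w₁ 1 - w₁ 0), abs_nonneg (w 0 - w 1)]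

theorem abs_meanZeroPrimitive_sub_le_mul (h : IsKinkData w w₁) (hδ : 0 < δ) (hδ1 : δ ≤ 1 / 2)
    {x : ℝ} (hx : x ∈ Icc δ (1 - δ)) : |meanZeroPrimitive (smoothed w w₁ δ) x - w x|
      ≤ 4 * (|w₁ 1 - w₁ 0| + |w 0 - w 1|) * δ := by
  rw [h.meanZeroPrimitive_sub hδ hδ1]
  have h1 := h.abs_integral_smoothed_sub_le_mul hδ hδ1 hx
  have h2 := h.abs_integral_error_le hδ hδ1
  refine (abs_sub _ _).trans ?_
  linarith

/-- The error of the logarithmic derivative is not uniformly small, since it stays of order one near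
the kink; its integral is, because the boundary layers are short. This gives `C¹` convergence of the
lifts. -/
theorem abs_logDerivPrimitive_sub_le (h : IsKinkData w w₁) (hδ : 0 < δ) (hδ1 : δ ≤ 1 / 2) {x : ℝ}
    (hx : x ∈ Icc (0 : ℝ) 1) : |logDerivPrimitive (smoothed w w₁ δ) x - ∫ y in 0..x, w y|
      ≤ 12 * (|w₁ 1 - w₁ 0| + |w 0 - w 1|) * δ := by
  have hc : Continuous (meanZeroPrimitive (smoothed w w₁ δ)) :=
    (contDiff_meanZeroPrimitive (h.continuous_smoothed hδ hδ1)).continuous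
  have hw : IntervalIntegrable w volume 0 x := by
    refine (h.continuousOn.mono ?_).intervalIntegrable
    rw [uIcc_of_le hx.1]
    exact Icc_subset_Icc_right hx.2
  have hcd : ContinuousOn (fun y => meanZeroPrimitive (smoothed w w₁ δ) y - w y) (Icc 0 1) :=
    hc.continuousOn.sub h.continuousOn
  rw [logDerivPrimitive, ← intervalIntegral.integral_sub (hc.intervalIntegrable _ _) hw]
  refine (intervalIntegral.abs_integral_le_integral_abs hx.1).trans ?_
  have h1 : ∫ y in 0..x, |meanZeroPrimitive (smoothed w w₁ δ) y - w y|
      ≤ ∫ y in 0..1, |meanZeroPrimitive (smoothed w w₁ δ) y - w y| := by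
    refine intervalIntegral.integral_mono_interval le_rfl hx.1 hx.2
      (Eventually.of_forall fun y => abs_nonneg _) ?_
    refine ContinuousOn.intervalIntegrable ?_
    rw [uIcc_of_le zero_le_one]
    exact hcd.abs
  have h2 := integral_abs_le_of_le_ends hδ hδ1
    (by positivity : 0 ≤ 4 * (|w₁ 1 - w₁ 0| + |w 0 - w 1|)) hcd
    (fun _ hx => h.abs_meanZeroPrimitive_sub_le hδ hδ1 hx)
    fun _ hx => h.abs_meanZeroPrimitive_sub_le_mul hδ hδ1 hx
  linarith

end IsKinkData

/-! ### Diffeomorphisms of the interval -/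

theorem ContDiffOn.eq_add_integral_derivWithin {f : ℝ → ℝ} (hf : ContDiffOn ℝ 1 f (Icc 0 1))
    {x : ℝ} (hx : x ∈ Icc (0 : ℝ) 1) :
    f x = f 0 + ∫ y in 0..x, derivWithin f (Icc 0 1) y := by
  have hsub : Icc 0 x ⊆ Icc (0 : ℝ) 1 := Icc_subset_Icc_right hx.2
  have hc : ContinuousOn (derivWithin f (Icc 0 1)) (Icc 0 1) :=
    hf.continuousOn_derivWithin (uniqueDiffOn_Icc zero_lt_one) le_rfl
  rw [intervalIntegral.integral_eq_sub_of_hasDerivAt_of_le hx.1 (hf.continuousOn.mono hsub)]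
  · ring
  · intro y hy
    have hy' : Icc (0 : ℝ) 1 ∈ 𝓝 y := Icc_mem_nhds hy.1 (hy.2.trans_le hx.2)
    exact ((hf.differentiableOn one_ne_zero) y (hsub ⟨hy.1.le, hy.2.le⟩)).hasDerivWithinAt.hasDerivAt
      hy'
  · refine (hc.mono ?_).intervalIntegrable
    rwa [uIcc_of_le hx.1]

/-- The logarithmic derivative `g'' / g'` on `[0, 1]`. -/
noncomputable def intervalLogDeriv (g : ℝ → ℝ) (x : ℝ) : ℝ :=
  iteratedDerivWithin 2 g (Icc 0 1) x / derivWithin g (Icc 0 1) x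

namespace IsIntervalDiff

variable {g : ℝ → ℝ}

theorem contDiffOn_derivWithin (hg : IsIntervalDiff 3 g) :
    ContDiffOn ℝ 2 (derivWithin g (Icc 0 1)) (Icc 0 1) :=
  hg.contDiffOn.derivWithin (uniqueDiffOn_Icc zero_lt_one) (by norm_num)

theorem iteratedDerivWithin_two_eq (g : ℝ → ℝ) : iteratedDerivWithin 2 g (Icc 0 1)
    = derivWithin (derivWithin g (Icc 0 1)) (Icc 0 1) := by
  rw [iteratedDerivWithin_succ', iteratedDerivWithin_one]

theorem contDiffOn_intervalLogDeriv (hg : IsIntervalDiff 3 g) :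
    ContDiffOn ℝ 1 (intervalLogDeriv g) (Icc 0 1) := by
  have h1 := hg.contDiffOn_derivWithin
  have h2 : ContDiffOn ℝ 1 (iteratedDerivWithin 2 g (Icc 0 1)) (Icc 0 1) := by
    rw [iteratedDerivWithin_two_eq]
    exact h1.derivWithin (uniqueDiffOn_Icc zero_lt_one) (by norm_num)
  exact h2.div (h1.of_le (by norm_num)) fun x hx => (hg.deriv_pos x hx).ne'

/-- Integrate `(log g')' = g''/g'`. -/
theorem derivWithin_eq (hg : IsIntervalDiff 3 g) {x : ℝ} (hx : x ∈ Icc (0 : ℝ) 1) :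
    derivWithin g (Icc 0 1) x
      = derivWithin g (Icc 0 1) 0 * Real.exp (∫ y in 0..x, intervalLogDeriv g y) := by
  have h1 := hg.contDiffOn_derivWithin
  have h2 : ContDiffOn ℝ 1 (fun x => Real.log (derivWithin g (Icc 0 1) x)) (Icc 0 1) :=
    (h1.of_le (by norm_num)).log fun x hx => (hg.deriv_pos x hx).ne'
  have h3 := h2.eq_add_integral_derivWithin hx
  have h4 : ∫ y in 0..x, derivWithin (fun x => Real.log (derivWithin g (Icc 0 1) x)) (Icc 0 1) y
      = ∫ y in 0..x, intervalLogDeriv g y := by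
    refine intervalIntegral.integral_congr fun y hy => ?_
    rw [uIcc_of_le hx.1] at hy
    have hy' : y ∈ Icc (0 : ℝ) 1 := ⟨hy.1, hy.2.trans hx.2⟩
    rw [derivWithin.log (h1.differentiableOn (by norm_num) y hy') (hg.deriv_pos y hy').ne'
      (uniqueDiffOn_Icc zero_lt_one y hy'), intervalLogDeriv, iteratedDerivWithin_two_eq]
  rw [h4] at h3
  rw [← Real.exp_log (hg.deriv_pos x hx), h3, Real.exp_add,
    Real.exp_log (hg.deriv_pos 0 (by simp))]

/-- Equality of `g'` at the two ends is equivalent to zero mean of `g''/g'`, by the exponential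
formula for `g'`. -/
theorem isKinkData (hg : IsIntervalDiff 3 g)
    (h01 : derivWithin g (Icc 0 1) 0 = derivWithin g (Icc 0 1) 1) :
    IsKinkData (intervalLogDeriv g) (derivWithin (intervalLogDeriv g) (Icc 0 1)) where
  continuousOn := hg.contDiffOn_intervalLogDeriv.continuousOn
  continuousOn_deriv := hg.contDiffOn_intervalLogDeriv.continuousOn_derivWithin
    (uniqueDiffOn_Icc zero_lt_one) le_rfl
  eq_integral x hx := hg.contDiffOn_intervalLogDeriv.eq_add_integral_derivWithin hx
  integral_eq_zero := by
    have h := hg.derivWithin_eq (x := 1) (by simp)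
    rw [← h01] at h
    have h0 := (hg.deriv_pos 0 (by simp)).ne'
    have h1 : Real.exp (∫ y in 0..1, intervalLogDeriv g y) = 1 :=
      mul_left_cancel₀ h0 (by rw [mul_one]; exact h.symm)
    exact Real.exp_eq_one_iff _ |>.1 h1

/-- Since `g` has increment `1`, its normalizing constant has the same form as the one in
`liftOfLogDeriv`; this makes the derivatives comparable. -/
theorem derivWithin_zero_eq (hg : IsIntervalDiff 3 g) : derivWithin g (Icc 0 1) 0
    = (∫ x in 0..1, Real.exp (∫ y in 0..x, intervalLogDeriv g y))⁻¹ := by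
  have h1 := (hg.contDiffOn.of_le (by norm_num)).eq_add_integral_derivWithin
    (x := 1) (by simp)
  rw [hg.map_one, hg.map_zero, zero_add] at h1
  have h2 : ∫ y in 0..1, derivWithin g (Icc 0 1) y = derivWithin g (Icc 0 1) 0
      * ∫ x in 0..1, Real.exp (∫ y in 0..x, intervalLogDeriv g y) := by
    rw [← intervalIntegral.integral_const_mul]
    refine intervalIntegral.integral_congr fun y hy => ?_
    rw [uIcc_of_le zero_le_one] at hy
    exact hg.derivWithin_eq hy
  rw [h2] at h1
  exact eq_inv_of_mul_eq_one_left h1.symm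

theorem derivWithin_eq_deriv {k : ℕ} {F : ℝ → ℝ} (hF : IsCircleLift k F)
    (hFg : ∀ x ∈ Icc (0 : ℝ) 1, F x = g x) {x : ℝ} (hx : x ∈ Icc (0 : ℝ) 1) :
    derivWithin g (Icc 0 1) x = deriv F x :=
  ((hF.hasDerivAt x).hasDerivWithinAt.congr (fun y hy => (hFg y hy).symm)
    (hFg x hx).symm).derivWithin (uniqueDiffOn_Icc zero_lt_one x hx)

end IsIntervalDiff

/-- The data of a sequence of smooth lifts `Fs n` that approximate the lift `F` with kinks at the
integers that is given on `[0, 1]` by `g`. -/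
structure IsSmoothing (a : ℝ) (g F : ℝ → ℝ) (Fs B : ℕ → ℝ → ℝ) (δ : ℕ → ℝ) (C : ℝ) : Prop where
  pos : ∀ n, 0 < δ n
  le_half : ∀ n, δ n ≤ 1 / 2
  tendsto_zero : Tendsto δ atTop (𝓝 0)
  isCircleLift : ∀ n, IsCircleLift 3 (Fs n)
  map_zero : ∀ n, Fs n 0 = 0
  potential_eq : ∀ n x, orbitalPotential a (Fs n) x
    = B n x + (intervalLogDeriv g 0 - intervalLogDeriv g 1) * bump (δ n) x
  continuous : ∀ n, Continuous (B n)
  abs_le : ∀ n x, |B n x| ≤ C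
  tendsto_potential : ∀ (x : ℝ) (xs : ℕ → ℝ), 0 < Int.fract x → Tendsto xs atTop (𝓝 x) →
    Tendsto (fun n => B n (xs n)) atTop (𝓝 (pinnedPotential a g x))
  tendstoUniformly_deriv : TendstoUniformly (fun n => deriv (Fs n)) (deriv F) atTop

/-! ### Existence and convergence of the smoothings -/

theorem abs_sub_le_of_exp_le {x y η : ℝ} (hy : 0 ≤ y) (h1 : Real.exp (-η) * y ≤ x)
    (h2 : x ≤ Real.exp η * y) : |x - y| ≤ y * (Real.exp η - 1) := by
  have h3 : 2 ≤ Real.exp η + Real.exp (-η) := by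
    have := Real.one_le_cosh η
    rw [Real.cosh_eq] at this
    linarith
  rw [abs_le]
  constructor <;> nlinarith

/-- If the logarithmic derivatives are close, then the normalized derivatives are close. -/
theorem exp_mul_le_of_abs_sub_le {L₁ L₂ : ℝ → ℝ} {η : ℝ} (h1 : ContinuousOn L₁ (Icc 0 1))
    (h2 : ContinuousOn L₂ (Icc 0 1)) (h : ∀ x ∈ Icc (0 : ℝ) 1, |L₁ x - L₂ x| ≤ η) {x : ℝ}
    (hx : x ∈ Icc (0 : ℝ) 1) :
    (∫ y in 0..1, Real.exp (L₁ y))⁻¹ * Real.exp (L₁ x)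
      ≤ Real.exp (2 * η) * ((∫ y in 0..1, Real.exp (L₂ y))⁻¹ * Real.exp (L₂ x)) := by
  have hi {L : ℝ → ℝ} (hL : ContinuousOn L (Icc 0 1)) :
      IntervalIntegrable (fun y => Real.exp (L y)) volume 0 1 := by
    refine ContinuousOn.intervalIntegrable ?_
    rw [uIcc_of_le zero_le_one]
    exact hL.rexp
  have hpos {L : ℝ → ℝ} (hL : ContinuousOn L (Icc 0 1)) : 0 < ∫ y in 0..1, Real.exp (L y) :=
    intervalIntegral.intervalIntegral_pos_of_pos (hi hL) (fun _ => Real.exp_pos _) one_pos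
  have h3 : ∫ y in 0..1, Real.exp (L₂ y) ≤ Real.exp η * ∫ y in 0..1, Real.exp (L₁ y) := by
    rw [← intervalIntegral.integral_const_mul]
    refine intervalIntegral.integral_mono_on zero_le_one (hi h2) ((hi h1).const_mul _)
      fun y hy => ?_
    rw [← Real.exp_add]
    exact Real.exp_le_exp.2 (by linarith [(abs_le.1 (h y hy)).1])
  have h4 : Real.exp (L₁ x) ≤ Real.exp η * Real.exp (L₂ x) := by
    rw [← Real.exp_add]
    exact Real.exp_le_exp.2 (by linarith [(abs_le.1 (h x hx)).2])
  have h5 : (∫ y in 0..1, Real.exp (L₁ y))⁻¹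
      ≤ Real.exp η * (∫ y in 0..1, Real.exp (L₂ y))⁻¹ := by
    rw [← div_eq_mul_inv, inv_eq_one_div, div_le_div_iff₀ (hpos h1) (hpos h2), one_mul]
    exact h3
  calc _ ≤ (Real.exp η * (∫ y in 0..1, Real.exp (L₂ y))⁻¹) * (Real.exp η * Real.exp (L₂ x)) :=
        mul_le_mul h5 h4 (Real.exp_pos _).le
          (mul_nonneg (Real.exp_pos _).le (inv_nonneg.2 (hpos h2).le))
    _ = _ := by rw [two_mul, Real.exp_add]; ring

/-- Take `liftOfLogDeriv` of `smoothed w w₁ δₙ`, where `w = g''/g'`, `w₁ = w'` and `δₙ → 0`. The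
bump is the only unbounded part of the potential; everything else is collected in `B`. -/
theorem exists_isSmoothing (a : ℝ) {g F : ℝ → ℝ} (hg : IsIntervalDiff 3 g)
    (hF : IsCircleLift 1 F) (hFg : ∀ x ∈ Icc (0 : ℝ) 1, F x = g x) :
    ∃ Fs B δ C, IsSmoothing a g F Fs B δ C := by
  have hd {x : ℝ} (hx : x ∈ Icc (0 : ℝ) 1) : derivWithin g (Icc 0 1) x = deriv F x :=
    IsIntervalDiff.derivWithin_eq_deriv hF hFg hx
  have h01 : derivWithin g (Icc 0 1) 0 = derivWithin g (Icc 0 1) 1 := by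
    rw [hd (by simp), hd (by simp)]
    simpa using (hF.periodic_deriv 0).symm
  have hk := hg.isKinkData h01
  set w := intervalLogDeriv g
  set w₁ := derivWithin w (Icc 0 1)
  set K := |w₁ 1 - w₁ 0| + |w 0 - w 1|
  have hK : 0 ≤ K := by positivity
  set δ : ℕ → ℝ := fun n => 1 / 2 * (1 / ((n : ℝ) + 1))
  have hδ (n : ℕ) : 0 < δ n := by positivity
  have hδ1 (n : ℕ) : δ n ≤ 1 / 2 := by
    have : 1 / ((n : ℝ) + 1) ≤ 1 := by
      rw [div_le_one (by positivity)]
      linarith [(Nat.cast_nonneg n : (0 : ℝ) ≤ n)]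
    simp only [δ]
    linarith
  have hδ0 : Tendsto δ atTop (𝓝 0) := by
    have := (tendsto_one_div_add_atTop_nhds_zero_nat (𝕜 := ℝ)).const_mul (1 / 2 : ℝ)
    rwa [mul_zero] at this
  set v : ℕ → ℝ → ℝ := fun n => smoothed w w₁ (δ n)
  have hv (n : ℕ) : Continuous (v n) := hk.continuous_smoothed (hδ n) (hδ1 n)
  have hvp (n : ℕ) : Function.Periodic (v n) 1 := IsKinkData.periodic_smoothed w w₁ (δ n)
  have hv0 (n : ℕ) : ∫ y in 0..1, v n y = 0 := hk.integral_smoothed (hδ n) (hδ1 n)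
  have hlift (n : ℕ) : IsCircleLift 3 (liftOfLogDeriv (v n)) :=
    isCircleLift_liftOfLogDeriv (hv n) (hvp n) (hv0 n)
  have hfract (x : ℝ) : Int.fract x ∈ Icc (0 : ℝ) 1 :=
    ⟨Int.fract_nonneg x, (Int.fract_lt_one x).le⟩
  have hFc : Continuous (deriv F) := hF.continuous_deriv le_rfl
  -- multiplicative comparison of the derivatives
  set η : ℕ → ℝ := fun n => 2 * (12 * K * δ n)
  have hη0 : Tendsto η atTop (𝓝 0) := by
    simpa using (hδ0.const_mul (12 * K)).const_mul 2
  have hLc : ContinuousOn (fun x => ∫ y in 0..x, w y) (Icc 0 1) := by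
    have := intervalIntegral.continuousOn_primitive_interval (μ := volume) (f := w)
      (a := 0) (b := 1) (by
        rw [uIcc_of_le zero_le_one]
        exact hk.continuousOn.integrableOn_Icc)
    rwa [uIcc_of_le zero_le_one] at this
  have hF' {x : ℝ} (hx : x ∈ Icc (0 : ℝ) 1) : deriv F x
      = (∫ x in 0..1, Real.exp (∫ y in 0..x, w y))⁻¹ * Real.exp (∫ y in 0..x, w y) := by
    rw [← hd hx, hg.derivWithin_eq hx, hg.derivWithin_zero_eq]
  have hcmp (n : ℕ) (x : ℝ) : Real.exp (-η n) * deriv F x ≤ deriv (liftOfLogDeriv (v n)) x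
      ∧ deriv (liftOfLogDeriv (v n)) x ≤ Real.exp (η n) * deriv F x := by
    rw [← hF.periodic_deriv.apply_fract x, ← (hlift n).periodic_deriv.apply_fract x,
      hF' (hfract x), deriv_liftOfLogDeriv (hv n)]
    have hL := (contDiff_logDerivPrimitive (hv n)).continuous.continuousOn (s := Icc (0 : ℝ) 1)
    have hle : ∀ x ∈ Icc (0 : ℝ) 1, |logDerivPrimitive (v n) x - ∫ y in 0..x, w y|
      ≤ 12 * K * δ n := fun x hx => hk.abs_logDerivPrimitive_sub_le (hδ n) (hδ1 n) hx
    refine ⟨?_, exp_mul_le_of_abs_sub_le hL hLc hle (hfract x)⟩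
    have := exp_mul_le_of_abs_sub_le hLc hL
      (fun x hx => (abs_sub_comm _ _).trans_le (hle x hx)) (hfract x)
    rw [Real.exp_neg, inv_mul_le_iff₀ (Real.exp_pos _)]
    exact this
  obtain ⟨D, hD⟩ : ∃ D, ∀ x, deriv F x ≤ D := by
    obtain ⟨D, hD⟩ := isCompact_Icc.bddAbove_image (hFc.continuousOn (s := Icc (0 : ℝ) 1))
    refine ⟨D, fun x => ?_⟩
    rw [← hF.periodic_deriv.apply_fract x]
    exact hD (mem_image_of_mem _ (hfract x))
  have hD0 : 0 ≤ D := (hF.deriv_pos 0).le.trans (hD 0)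
  have hunif : TendstoUniformly (fun n => deriv (liftOfLogDeriv (v n))) (deriv F) atTop := by
    rw [Metric.tendstoUniformly_iff]
    intro ε hε
    have h1 : Tendsto (fun n => D * (Real.exp (η n) - 1)) atTop (𝓝 0) := by
      simpa using ((Real.continuous_exp.tendsto 0).comp hη0 |>.sub_const 1).const_mul D
    filter_upwards [h1.eventually (gt_mem_nhds hε)] with n hn x
    rw [dist_comm, Real.dist_eq]
    refine ((abs_sub_le_of_exp_le (hF.deriv_pos x).le (hcmp n x).1 (hcmp n x).2).trans ?_).trans_lt
      hn
    refine mul_le_mul_of_nonneg_right (hD x) ?_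
    have : (0 : ℝ) ≤ η n := by have := hδ n; positivity
    linarith [Real.add_one_le_exp (η n)]
  obtain ⟨M, hM⟩ : ∃ M, ∀ x ∈ Icc (0 : ℝ) 1, |w₁ x| ≤ M := by
    obtain ⟨M, hM⟩ := isCompact_Icc.bddAbove_image hk.continuousOn_deriv.abs
    exact ⟨M, fun x hx => hM (mem_image_of_mem _ hx)⟩
  obtain ⟨N, hN⟩ : ∃ N, ∀ x ∈ Icc (0 : ℝ) 1, |w x| ≤ N := by
    obtain ⟨M, hM⟩ := isCompact_Icc.bddAbove_image hk.continuousOn.abs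
    exact ⟨M, fun x hx => hM (mem_image_of_mem _ hx)⟩
  set B : ℕ → ℝ → ℝ := fun n x => endpointMatch w₁ (δ n) x
    - 1 / 2 * meanZeroPrimitive (v n) x ^ 2
    + 2 * a * (deriv (liftOfLogDeriv (v n)) x ^ 2 - 1)
  have hwp (n : ℕ) : Function.Periodic (meanZeroPrimitive (v n)) 1 :=
    periodic_meanZeroPrimitive (hv n) (hvp n) (hv0 n)
  refine ⟨fun n => liftOfLogDeriv (v n), B, δ,
    2 * M + 1 / 2 * (N + 4 * K) ^ 2 + 2 * |a| * ((Real.exp (12 * K) * D) ^ 2 + 1),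
    hδ, hδ1, hδ0, hlift, fun n => liftOfLogDeriv_zero _, ?_, ?_, ?_, ?_, hunif⟩
  · intro n x
    rw [orbitalPotential, schwarzianWithin_liftOfLogDeriv (hv n)]
    simp only [B, v, smoothed]
    ring
  · intro n
    have h1 := continuous_endpointMatch hk.continuousOn_deriv (hδ n) (by linarith [hδ1 n])
    have h2 := (contDiff_meanZeroPrimitive (hv n)).continuous
    have h3 := (hlift n).continuous_deriv (by norm_num)
    fun_prop
  · intro n x
    have h1 := abs_endpointMatch_le (hδ n) hM x
    have h2 : |meanZeroPrimitive (v n) x| ≤ N + 4 * K := by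
      rw [← (hwp n).apply_fract]
      have e1 := hk.abs_meanZeroPrimitive_sub_le (hδ n) (hδ1 n) (hfract x)
      have e2 := hN _ (hfract x)
      have e3 := abs_add_le (meanZeroPrimitive (v n) (Int.fract x) - w (Int.fract x))
        (w (Int.fract x))
      rw [sub_add_cancel] at e3
      linarith
    -- `η n ≤ 12 * K`, as `δ n ≤ 1 / 2`.
    have h3 : deriv (liftOfLogDeriv (v n)) x ≤ Real.exp (12 * K) * D := by
      refine (hcmp n x).2.trans (mul_le_mul (Real.exp_le_exp.2 ?_) (hD x) (hF.deriv_pos x).le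
        (Real.exp_pos _).le)
      have := mul_le_mul_of_nonneg_left (hδ1 n) (by positivity : 0 ≤ 24 * K)
      simp only [η]
      linarith
    have h4 : |meanZeroPrimitive (v n) x ^ 2| ≤ (N + 4 * K) ^ 2 := by
      rw [abs_pow]
      exact pow_le_pow_left₀ (abs_nonneg _) h2 2
    have h5 : |deriv (liftOfLogDeriv (v n)) x ^ 2 - 1| ≤ (Real.exp (12 * K) * D) ^ 2 + 1 := by
      refine (abs_sub _ _).trans ?_
      rw [abs_one, abs_pow, abs_of_pos ((hlift n).deriv_pos x)]
      exact add_le_add_left (pow_le_pow_left₀ ((hlift n).deriv_pos x).le h3 2) 1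
    refine (abs_add_le _ _).trans (add_le_add ((abs_sub _ _).trans (add_le_add h1 ?_)) ?_)
    · rw [abs_mul, abs_of_pos (by norm_num : (0 : ℝ) < 1 / 2)]
      linarith
    · rw [abs_mul, abs_mul, abs_two]
      exact mul_le_mul_of_nonneg_left h5 (by positivity)
  · intro x xs hx hxs
    have hfl : x ≠ ⌊x⌋ := Int.fract_pos.1 hx
    have h1 : Tendsto (fun n => Int.fract (xs n)) atTop (𝓝 (Int.fract x)) :=
      (continuousAt_fract hfl).tendsto.comp hxs
    have hnhds : Icc (0 : ℝ) 1 ∈ 𝓝 (Int.fract x) := Icc_mem_nhds hx (Int.fract_lt_one x)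
    -- Away from the integers, the moving point eventually leaves the shrinking boundary layers,
    -- where the correction terms live.
    have hmem : ∀ᶠ n in atTop, Int.fract (xs n) ∈ Icc (δ n) (1 - δ n) := by
      have e1 := hδ0.eventually_lt h1 hx
      have e2 := (h1.add hδ0).eventually_lt_const (u := 1) (by simpa using Int.fract_lt_one x)
      filter_upwards [e1, e2] with n h1 h2
      exact ⟨h1.le, by linarith⟩
    have t1 : Tendsto (fun n => endpointMatch w₁ (δ n) (xs n)) atTop (𝓝 (w₁ (Int.fract x))) := by
      refine ((hk.continuousOn_deriv.continuousAt hnhds).tendsto.comp h1).congr' ?_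
      filter_upwards [hmem] with n hn
      exact (endpointMatch_eq (hδ n) hn).symm
    have t2 : Tendsto (fun n => meanZeroPrimitive (v n) (xs n)) atTop (𝓝 (w (Int.fract x))) := by
      have e1 : Tendsto (fun n => meanZeroPrimitive (v n) (Int.fract (xs n))
          - w (Int.fract (xs n))) atTop (𝓝 0) := by
        refine squeeze_zero_norm' (a := fun n => 4 * K * δ n) ?_
          (by simpa using hδ0.const_mul (4 * K))
        filter_upwards [hmem] with n hn
        exact hk.abs_meanZeroPrimitive_sub_le_mul (hδ n) (hδ1 n) hn
      have e2 := e1.add ((hk.continuousOn.continuousAt hnhds).tendsto.comp h1)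
      simp only [Function.comp_def, sub_add_cancel, zero_add] at e2
      refine e2.congr fun n => (hwp n).apply_fract _
    have t3 : Tendsto (fun n => deriv (liftOfLogDeriv (v n)) (xs n)) atTop
        (𝓝 (derivWithin g (Icc 0 1) (Int.fract x))) := by
      rw [hd (hfract x), hF.periodic_deriv.apply_fract]
      exact hunif.tendsto_comp hFc.continuousAt hxs
    exact (t1.sub ((t2.pow 2).const_mul _)).add (((t3.pow 2).sub_const 1).const_mul _)

namespace IsSmoothing

variable {a : ℝ} {g F : ℝ → ℝ} {Fs B : ℕ → ℝ → ℝ} {δ : ℕ → ℝ} {C : ℝ}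

theorem abs_sub_le {F₁ F₂ : ℝ → ℝ} (h1 : IsCircleLift 1 F₁) (h2 : IsCircleLift 1 F₂)
    (h0 : F₁ 0 = F₂ 0) {ε : ℝ} (h : ∀ x, |deriv F₁ x - deriv F₂ x| ≤ ε) {x : ℝ} (hx : 0 ≤ x) :
    |F₁ x - F₂ x| ≤ ε * x := by
  have := norm_image_sub_le_of_norm_deriv_le_segment' (f := fun x => F₁ x - F₂ x)
    (f' := fun x => deriv F₁ x - deriv F₂ x) (a := 0) (b := x) (C := ε)
    (fun y _ => ((h1.hasDerivAt y).sub (h2.hasDerivAt y)).hasDerivWithinAt) (fun y _ => h y) x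
    ⟨hx, le_rfl⟩
  simpa [h0] using this

theorem isCircleLift_one (h : IsSmoothing a g F Fs B δ C) (n : ℕ) : IsCircleLift 1 (Fs n) :=
  ⟨(h.isCircleLift n).contDiff.of_le (by norm_num), (h.isCircleLift n).deriv_pos,
    (h.isCircleLift n).add_one⟩

/-- Uniform convergence of the derivatives bounds `|Fₙ(ε) - F(ε)| / ε` uniformly in `ε`, so no
relation between the rates of `ε` and `δ` is needed. -/
theorem tendsto_div (h : IsSmoothing a g F Fs B δ C) (hF : IsCircleLift 1 F) (hF0 : F 0 = 0)
    {ε : ℕ → ℝ} (hε : ∀ n, 0 < ε n) (hε0 : Tendsto ε atTop (𝓝 0)) :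
    Tendsto (fun n => Fs n (ε n) / ε n) atTop (𝓝 (deriv F 0)) := by
  have h1 : Tendsto (fun n => F (ε n) / ε n) atTop (𝓝 (deriv F 0)) := by
    have := (hasDerivAt_iff_tendsto_slope.1 (hF.hasDerivAt 0)).comp
      (tendsto_nhdsWithin_iff.2 ⟨hε0, Eventually.of_forall fun n => (hε n).ne'⟩)
    refine this.congr fun n => ?_
    simp [slope_def_field, hF0]
  have h2 : Tendsto (fun n => Fs n (ε n) / ε n - F (ε n) / ε n) atTop (𝓝 0) := by
    rw [Metric.tendsto_nhds]
    intro η hη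
    filter_upwards [Metric.tendstoUniformly_iff.1 h.tendstoUniformly_deriv (η / 2) (half_pos hη)]
      with n hn
    have := abs_sub_le (h.isCircleLift_one n) hF ((h.map_zero n).trans hF0.symm) (ε := η / 2)
      (fun x => by rw [abs_sub_comm, ← Real.dist_eq]; exact (hn x).le) (hε n).le
    rw [dist_zero_right, ← sub_div, Real.norm_eq_abs, abs_div, abs_of_pos (hε n)]
    refine ((div_le_iff₀ (hε n)).2 this).trans_lt (half_lt_self hη)
  simpa using h2.add h1

theorem tendsto_circleDiff (h : IsSmoothing a g F Fs B δ C) (hF : IsCircleLift 1 F)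
    (hF0 : F 0 = 0) {f : CircleDiff 1} (hf : ∀ x : ℝ, f (x : Circ) = (F x : Circ))
    {ψ : ℕ → CircleDiff 1} (hψ : ∀ n (x : ℝ), ψ n (x : Circ) = (Fs n x : Circ)) :
    Tendsto ψ atTop (𝓝 f) := by
  rw [CircleDiff.isInducing_toC1.tendsto_nhds_iff, nhds_prod_eq]
  refine Tendsto.prodMk ?_ ?_
  · rw [ContinuousMap.tendsto_iff_tendstoUniformly, Metric.tendstoUniformly_iff]
    intro ε hε
    filter_upwards [Metric.tendstoUniformly_iff.1 h.tendstoUniformly_deriv (ε / 2) (half_pos hε)]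
      with n hn t
    have h1 := abs_sub_le (h.isCircleLift_one n) hF ((h.map_zero n).trans hF0.symm) (ε := ε / 2)
      (fun x => by rw [abs_sub_comm, ← Real.dist_eq]; exact (hn x).le)
      (x := circRep t) (by rw [← coe_circRep t, circRep_coe]; exact Int.fract_nonneg _)
    have h2 : circRep t ≤ 1 := by
      rw [← coe_circRep t, circRep_coe]
      exact (Int.fract_lt_one _).le
    change dist (f t) (ψ n t) < ε
    rw [← coe_circRep t, hf, hψ, dist_comm, dist_eq_norm, ← AddCircle.coe_sub]
    refine (QuotientAddGroup.norm_mk_le_norm).trans_lt ?_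
    rw [Real.norm_eq_abs]
    nlinarith
  · rw [ContinuousMap.tendsto_iff_tendstoUniformly, Metric.tendstoUniformly_iff]
    intro ε hε
    filter_upwards [Metric.tendstoUniformly_iff.1 h.tendstoUniformly_deriv ε hε] with n hn t
    obtain ⟨x, rfl⟩ := exists_coe_circ t
    change dist (f.deriv x) ((ψ n).deriv x) < ε
    rw [CircleDiff.deriv_coe hF.continuous hf,
      CircleDiff.deriv_coe (h.isCircleLift n).continuous (hψ n)]
    exact hn x

end IsSmoothing

/-! ### Convergence of the densities -/

namespace IsCircleLift

variable {G : ℝ → ℝ}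

theorem integral_bump_comp_mul_deriv (hG : IsCircleLift 1 G) {δ : ℝ} (hδ : 0 < δ)
    (hδ1 : δ ≤ 1 / 2) (θ t : ℝ) :
    ∫ τ in t..t + 1, bump δ (G τ + θ) * deriv G τ = 1 := by
  have h1 := intervalIntegral.integral_comp_mul_deriv (a := t) (b := t + 1)
    (f := fun τ => G τ + θ) (f' := deriv G) (g := bump δ)
    (fun x _ => (hG.hasDerivAt x).add_const θ) (hG.continuous_deriv le_rfl).continuousOn
    (continuous_bump δ)
  simp only [Function.comp_def] at h1
  rw [h1, hG.add_one, show G t + 1 + θ = G t + θ + 1 by ring,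
    (periodic_bump δ).intervalIntegral_add_eq (G t + θ) 0, zero_add,
    integral_bump hδ (by linarith)]

/-- On the period centred at `t₀`, the values of `G` stay in a compact part of `(-1, 1)`. Thus `0`,
attained only at `t₀`, is the only integer near which the bump can be active. -/
theorem eventually_bump_ne_zero (hG : IsCircleLift 1 G) {t₀ : ℝ} (h0 : G t₀ = 0) {δ θ : ℕ → ℝ}
    (hδ : ∀ n, 0 < δ n) (hδ0 : Tendsto δ atTop (𝓝 0)) (hθ : Tendsto θ atTop (𝓝 0)) {ρ : ℝ}
    (hρ : 0 < ρ) :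
    ∀ᶠ n in atTop, ∀ τ ∈ Icc (t₀ - 1 / 2) (t₀ + 1 / 2), bump (δ n) (G τ + θ n) ≠ 0 →
      |τ - t₀| < ρ := by
  have hm := hG.strictMono
  have h1 : G (t₀ + 1) = 1 := by rw [hG.add_one, h0, zero_add]
  have h2 : G (t₀ - 1) = -1 := by
    have := hG.add_one (t₀ - 1)
    rw [sub_add_cancel, h0] at this
    linarith
  have p1 : 0 < G (t₀ + ρ) := h0 ▸ hm (by linarith)
  have p2 : G (t₀ + 1 / 2) < 1 := h1 ▸ hm (by linarith)
  have p3 : G (t₀ - ρ) < 0 := h0 ▸ hm (by linarith)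
  have p4 : -1 < G (t₀ - 1 / 2) := h2 ▸ hm (by linarith)
  have s1 : Tendsto (fun n => θ n + δ n) atTop (𝓝 0) := by simpa using hθ.add hδ0
  have s2 : Tendsto (fun n => δ n - θ n) atTop (𝓝 0) := by simpa using hδ0.sub hθ
  filter_upwards [s2.eventually_lt_const p1, s1.eventually_lt_const (sub_pos.2 p2),
    s1.eventually_lt_const (neg_pos.2 p3),
    s2.eventually_lt_const (by linarith : 0 < 1 + G (t₀ - 1 / 2))] with n e1 e2 e3 e4 τ hτ hne
  by_contra hcon
  rw [not_lt, le_abs] at hcon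
  apply hne
  have hδn := hδ n
  rcases hcon with hcon | hcon
  · have q1 : G (t₀ + ρ) ≤ G τ := hm.monotone (by linarith)
    have q2 : G τ ≤ G (t₀ + 1 / 2) := hm.monotone hτ.2
    apply bump_eq_zero (hδ n)
    rw [Int.fract_eq_self.2 ⟨by linarith, by linarith⟩]
    exact ⟨by linarith, by linarith⟩
  · have q1 : G (t₀ - 1 / 2) ≤ G τ := hm.monotone hτ.1
    have q2 : G τ ≤ G (t₀ - ρ) := hm.monotone (by linarith)
    rw [← periodic_bump (δ n) (G τ + θ n)]
    apply bump_eq_zero (hδ n)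
    rw [Int.fract_eq_self.2 ⟨by linarith, by linarith⟩]
    exact ⟨by linarith, by linarith⟩

/-- One factor `G'` turns the bump into an approximate identity of mass `1` concentrating at `t₀`;
the other factor `G'` is evaluated there. -/
theorem tendsto_integral_bump (hG : IsCircleLift 1 G) {t₀ : ℝ} (h0 : G t₀ = 0) {δ θ : ℕ → ℝ}
    (hδ : ∀ n, 0 < δ n) (hδ1 : ∀ n, δ n ≤ 1 / 2) (hδ0 : Tendsto δ atTop (𝓝 0))
    (hθ : Tendsto θ atTop (𝓝 0)) :
    Tendsto (fun n => ∫ τ in (t₀ - 1 / 2)..(t₀ - 1 / 2 + 1),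
      bump (δ n) (G τ + θ n) * deriv G τ ^ 2) atTop (𝓝 (deriv G t₀)) := by
  have hc := hG.continuous_deriv le_rfl
  have hGc := hG.continuous
  have hle : t₀ - 1 / 2 ≤ t₀ - 1 / 2 + 1 := by linarith
  rw [Metric.tendsto_nhds]
  intro ε hε
  obtain ⟨ρ, hρ, hρε⟩ := Metric.continuousAt_iff.1 (hc.continuousAt (x := t₀)) (ε / 2) (half_pos hε)
  filter_upwards [hG.eventually_bump_ne_zero h0 hδ hδ0 hθ hρ] with n hn
  have hb := continuous_bump (δ n)
  have h1 := hG.integral_bump_comp_mul_deriv (hδ n) (hδ1 n) (θ n) (t₀ - 1 / 2)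
  have h2 : (∫ τ in (t₀ - 1 / 2)..(t₀ - 1 / 2 + 1), bump (δ n) (G τ + θ n) * deriv G τ ^ 2)
      - deriv G t₀ = ∫ τ in (t₀ - 1 / 2)..(t₀ - 1 / 2 + 1),
        bump (δ n) (G τ + θ n) * deriv G τ * (deriv G τ - deriv G t₀) := by
    have h3 := congrArg (deriv G t₀ * ·) h1
    simp only [mul_one] at h3
    conv_lhs => rw [← h3, ← intervalIntegral.integral_const_mul]
    rw [← intervalIntegral.integral_sub (Continuous.intervalIntegrable (by fun_prop) _ _)
      (Continuous.intervalIntegrable (by fun_prop) _ _)]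
    refine intervalIntegral.integral_congr fun τ _ => ?_
    ring
  rw [Real.dist_eq, h2]
  refine ((intervalIntegral.abs_integral_le_integral_abs hle).trans ?_).trans_lt (half_lt_self hε)
  have h4 := congrArg (ε / 2 * ·) h1
  simp only [mul_one] at h4
  rw [← h4, ← intervalIntegral.integral_const_mul]
  refine intervalIntegral.integral_mono_on hle (Continuous.intervalIntegrable (by fun_prop) _ _)
    (Continuous.intervalIntegrable (by fun_prop) _ _) fun τ hτ => ?_
  have h3 : 0 ≤ bump (δ n) (G τ + θ n) * deriv G τ :=
    mul_nonneg (bump_nonneg (hδ n) _) (hG.deriv_pos τ).le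
  rw [abs_mul, abs_of_nonneg h3, mul_comm]
  by_cases hne : bump (δ n) (G τ + θ n) = 0
  · simp [hne]
  · refine mul_le_mul_of_nonneg_right ?_ h3
    exact (hρε (hn τ ⟨hτ.1, by linarith [hτ.2]⟩ hne)).le

end IsCircleLift

theorem CircleDiff.exists_isCircleLift_of_apply_eq_zero {φ : CircleDiff 1} {t₀ : ℝ}
    (h : φ (t₀ : Circ) = 0) :
    ∃ G, IsCircleLift 1 G ∧ (∀ x : ℝ, φ (x : Circ) = (G x : Circ)) ∧ G t₀ = 0 := by
  rw [φ.coe_lift, ← AddCircle.coe_zero] at h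
  obtain ⟨n, hn⟩ := coe_circ_eq_iff.1 h
  have hφ := φ.isCircleLift_lift
  refine ⟨fun x => φ.lift x - n, ⟨hφ.contDiff.sub contDiff_const, fun x => ?_, fun x => ?_⟩,
    fun x => ?_, ?_⟩
  · simpa using hφ.deriv_pos x
  · rw [hφ.add_one]
    ring
  · rw [φ.coe_lift]
    exact coe_circ_eq_iff.2 ⟨n, by ring⟩
  · simp only [hn]
    ring

namespace IsSmoothing

variable {a : ℝ} {g F : ℝ → ℝ} {Fs B : ℕ → ℝ → ℝ} {δ : ℕ → ℝ} {C : ℝ}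

theorem orbitalDensity_rot_mul (h : IsSmoothing a g F Fs B δ C) (σ : ℝ) {ψ : ℕ → CircleDiff 3}
    (hψ : ∀ n (x : ℝ), ψ n (x : Circ) = (Fs n x : Circ)) {φ : CircleDiff 1} {G : ℝ → ℝ}
    (hG : IsCircleLift 1 G) (hφ : ∀ x : ℝ, φ (x : Circ) = (G x : Circ)) (n : ℕ) (θ t : ℝ) :
    orbitalDensity σ a (ψ n) (CircleDiff.rot θ * φ) = Real.exp (1 / σ ^ 2 *
      ((intervalLogDeriv g 0 - intervalLogDeriv g 1) *
          (∫ τ in t..t + 1, bump (δ n) (G τ + θ) * deriv G τ ^ 2)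
        + ∫ τ in t..t + 1, B n (G τ + θ) * deriv G τ ^ 2)) := by
  have hc := hG.continuous_deriv le_rfl
  have hGc := hG.continuous
  have hb := continuous_bump (δ n)
  have hB := h.continuous n
  rw [orbitalDensity_eq σ a (h.isCircleLift n) (hψ n) (G := fun τ => G τ + θ) (by fun_prop)
    (fun x => by rw [CircleDiff.mul_apply, CircleDiff.rot_apply, hφ, AddCircle.coe_add]) t]
  congr 2
  rw [← intervalIntegral.integral_const_mul, ← intervalIntegral.integral_add
    (Continuous.intervalIntegrable (by fun_prop) _ _)
    (Continuous.intervalIntegrable (by fun_prop) _ _)]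
  refine intervalIntegral.integral_congr fun τ _ => ?_
  simp only [deriv_add_const, h.potential_eq]
  ring

/-- This bound, uniform in `n` and `θ`, is what dominates the integrands. Although the bump blows
up, its integral against `φ'` is `1`, and only the second factor `φ'` costs an `R`. -/
theorem orbitalDensity_rot_mul_le (h : IsSmoothing a g F Fs B δ C) (σ : ℝ)
    {ψ : ℕ → CircleDiff 3} (hψ : ∀ n (x : ℝ), ψ n (x : Circ) = (Fs n x : Circ))
    {φ : CircleDiff 1} {R : ℝ} (hR : ∀ t, φ.deriv t ≤ R) (n : ℕ) (θ : ℝ) :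
    orbitalDensity σ a (ψ n) (CircleDiff.rot θ * φ) ≤ Real.exp (1 / σ ^ 2 *
      (|intervalLogDeriv g 0 - intervalLogDeriv g 1| * R + C * R ^ 2)) := by
  have hG := φ.isCircleLift_lift
  have hc := hG.continuous_deriv le_rfl
  have hGc := hG.continuous
  have hb := continuous_bump (δ n)
  have hB := h.continuous n
  have hR0 : 0 ≤ R := (φ.deriv_pos 0).le.trans (hR 0)
  have hR' (τ : ℝ) : deriv φ.lift τ ≤ R := hR (τ : Circ)
  have hC : 0 ≤ C := (abs_nonneg _).trans (h.abs_le n 0)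
  rw [h.orbitalDensity_rot_mul σ hψ hG φ.coe_lift n θ 0]
  refine Real.exp_le_exp.2 (mul_le_mul_of_nonneg_left (add_le_add ?_ ?_) (by positivity))
  · have h1 : 0 ≤ ∫ τ in (0 : ℝ)..0 + 1, bump (δ n) (φ.lift τ + θ) * deriv φ.lift τ ^ 2 :=
      intervalIntegral.integral_nonneg (by simp) fun τ _ =>
        mul_nonneg (bump_nonneg (h.pos n) _) (sq_nonneg _)
    have h2 : ∫ τ in (0 : ℝ)..0 + 1, bump (δ n) (φ.lift τ + θ) * deriv φ.lift τ ^ 2 ≤ R := by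
      have h4 := congrArg (R * ·)
        (hG.integral_bump_comp_mul_deriv (h.pos n) (h.le_half n) θ 0)
      simp only [mul_one] at h4
      rw [← h4, ← intervalIntegral.integral_const_mul]
      refine intervalIntegral.integral_mono_on (by simp)
        (Continuous.intervalIntegrable (by fun_prop) _ _)
        (Continuous.intervalIntegrable (by fun_prop) _ _) fun τ _ => ?_
      have h3 : 0 ≤ bump (δ n) (φ.lift τ + θ) * deriv φ.lift τ :=
        mul_nonneg (bump_nonneg (h.pos n) _) (hG.deriv_pos τ).le
      calc _ = deriv φ.lift τ * (bump (δ n) (φ.lift τ + θ) * deriv φ.lift τ) := by ring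
        _ ≤ _ := mul_le_mul_of_nonneg_right (hR' τ) h3
    calc _ ≤ |intervalLogDeriv g 0 - intervalLogDeriv g 1| * _ :=
          mul_le_mul_of_nonneg_right (le_abs_self _) h1
      _ ≤ _ := mul_le_mul_of_nonneg_left h2 (abs_nonneg _)
  · have h1 := intervalIntegral.norm_integral_le_of_norm_le_const (a := 0) (b := 0 + 1)
      (f := fun τ => B n (φ.lift τ + θ) * deriv φ.lift τ ^ 2) (C := C * R ^ 2) fun τ _ => by
        rw [norm_mul, norm_pow, Real.norm_eq_abs, Real.norm_eq_abs,
          abs_of_pos (hG.deriv_pos τ)]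
        exact mul_le_mul (h.abs_le n _) (pow_le_pow_left₀ (hG.deriv_pos τ).le (hR' τ) 2)
          (by positivity) hC
    simp only [zero_add, sub_zero, abs_one, mul_one] at h1 ⊢
    exact (le_abs_self _).trans h1

/-- The bump yields the boundary term and `B` the integral of the potential of `g`. The limit is the
bare exponential, so the square root is multiplied back. -/
theorem tendsto_orbitalDensity (h : IsSmoothing a g F Fs B δ C) (hg : IsIntervalDiff 3 g) (σ : ℝ)
    {ψ : ℕ → CircleDiff 3} (hψ : ∀ n (x : ℝ), ψ n (x : Circ) = (Fs n x : Circ))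
    {φ : CircleDiff 1} {t₀ : ℝ}
    (hφ : φ (t₀ : Circ) = 0) {θ : ℕ → ℝ} (hθ : Tendsto θ atTop (𝓝 0)) :
    Tendsto (fun n => orbitalDensity σ a (ψ n) (CircleDiff.rot (θ n : ℝ) * φ)) atTop
      (𝓝 (Real.sqrt (derivWithin g (Icc 0 1) 0 * derivWithin g (Icc 0 1) 1)
        * pinnedDensity σ a t₀ g φ)) := by
  obtain ⟨G, hG, hφG, h0⟩ := CircleDiff.exists_isCircleLift_of_apply_eq_zero hφ
  have hc := hG.continuous_deriv le_rfl
  have hGc := hG.continuous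
  have hm := hG.strictMono
  have hle : t₀ - 1 / 2 ≤ t₀ - 1 / 2 + 1 := by linarith
  have hsqrt : Real.sqrt (derivWithin g (Icc 0 1) 0 * derivWithin g (Icc 0 1) 1) ≠ 0 :=
    (Real.sqrt_pos.2 (mul_pos (hg.deriv_pos 0 (by simp)) (hg.deriv_pos 1 (by simp)))).ne'
  rw [pinnedDensity_eq σ a g hG.continuous hφG t₀ (t₀ - 1 / 2), ← mul_assoc,
    mul_one_div_cancel hsqrt, one_mul]
  simp only [fun n => h.orbitalDensity_rot_mul σ hψ hG hφG n (θ n) (t₀ - 1 / 2)]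
  refine (Real.continuous_exp.tendsto _).comp (Tendsto.const_mul _ (Tendsto.add
    ((hG.tendsto_integral_bump h0 h.pos h.le_half h.tendsto_zero hθ).const_mul _) ?_))
  refine intervalIntegral.tendsto_integral_filter_of_dominated_convergence
    (fun τ => C * deriv G τ ^ 2) (Eventually.of_forall fun n => ?_)
    (Eventually.of_forall fun n => Eventually.of_forall fun τ _ => ?_)
    (Continuous.intervalIntegrable (by fun_prop) _ _) ?_
  · have := h.continuous n
    exact Continuous.aestronglyMeasurable (by fun_prop)
  · rw [norm_mul, Real.norm_eq_abs, Real.norm_eq_abs, abs_of_nonneg (sq_nonneg (deriv G τ))]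
    exact mul_le_mul_of_nonneg_right (h.abs_le n _) (sq_nonneg _)
  · have h1 : ∀ᵐ τ : ℝ, τ ≠ t₀ := by simp [ae_iff]
    filter_upwards [h1] with τ hτ hτm
    rw [uIoc_of_le hle] at hτm
    refine Tendsto.mul_const _ (h.tendsto_potential _ _ ?_ ?_)
    -- On this period `G τ` lies strictly between `-1` and `1`; an integer value would be `0 = G
    -- t₀`.
    · refine Int.fract_pos.2 fun heq => hτ (hm.injective ?_)
      have e1 : G (t₀ + 1) = 1 := by rw [hG.add_one, h0, zero_add]
      have e2 : G (t₀ - 1) = -1 := by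
        have := hG.add_one (t₀ - 1)
        rw [sub_add_cancel, h0] at this
        linarith
      have e3 : G τ < 1 := e1 ▸ hm (by linarith [hτm.2])
      have e4 : -1 < G τ := e2 ▸ hm (by linarith [hτm.1])
      rw [heq] at e3 e4
      have e5 : ⌊G τ⌋ < 1 := by exact_mod_cast e3
      have e6 : -1 < ⌊G τ⌋ := by exact_mod_cast e4
      rw [h0, heq, show ⌊G τ⌋ = 0 by omega, Int.cast_zero]
    · simpa using hθ.const_add (G τ)

end IsSmoothing

/-! ### The change of variables formula -/

/-- Two Borel measures on a separable metrizable space agree if they agree on continuous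
functions with support in small open sets. -/
theorem MeasureTheory.Measure.ext_of_forall_lintegral_eq_locally {X : Type*} [TopologicalSpace X]
    [TopologicalSpace.MetrizableSpace X] [SecondCountableTopology X] [MeasurableSpace X]
    [BorelSpace X] {μ ν : Measure X}
    (h : ∀ x, ∃ V, IsOpen V ∧ x ∈ V ∧ μ V < ∞ ∧
      ∀ H : X →ᵇ ℝ≥0, (∀ y ∉ V, H y = 0) → ∫⁻ y, H y ∂μ = ∫⁻ y, H y ∂ν) : μ = ν := by
  have key : ∀ x, ∃ O ∈ 𝓝 x, μ.restrict O = ν.restrict O := by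
    intro x
    obtain ⟨V, hV, hxV, hμV, hH⟩ := h x
    -- Weighting by a cutoff `c` supported in `V` makes `μ` finite and localizes every bounded
    -- continuous test function; dividing by `c` recovers both measures on the neighbourhood `{c ≠
    -- 0}` of `x`.
    obtain ⟨χ, hχ0, hχ1, hχ⟩ := exists_continuous_zero_one_of_isClosed hV.isClosed_compl
      (isClosed_singleton (x := x)) (by simpa using hxV)
    set c : X → ℝ≥0 := fun y => (χ y).toNNReal
    have hc : Continuous c := continuous_real_toNNReal.comp χ.continuous
    have hc1 (y : X) : c y ≤ 1 := by simpa [c] using (hχ y).2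
    have hcV (y : X) (hy : y ∉ V) : c y = 0 := by simp [c, hχ0 hy]
    have hcm : Measurable fun y => (c y : ℝ≥0∞) := hc.measurable.coe_nnreal_ennreal
    have hfin : IsFiniteMeasure (μ.withDensity fun y => (c y : ℝ≥0∞)) := by
      refine isFiniteMeasure_withDensity (ne_of_lt ?_)
      calc ∫⁻ y, (c y : ℝ≥0∞) ∂μ ≤ ∫⁻ y, V.indicator 1 y ∂μ := by
            refine lintegral_mono fun y => ?_
            by_cases hy : y ∈ V
            · simpa [hy] using hc1 y
            · simp [hcV y hy]
        _ = μ V := lintegral_indicator_one hV.measurableSet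
        _ < ∞ := hμV
    have heq : (μ.withDensity fun y => (c y : ℝ≥0∞)) = ν.withDensity fun y => (c y : ℝ≥0∞) := by
      refine ext_of_forall_lintegral_eq_of_IsFiniteMeasure fun k => ?_
      have hk : Measurable fun y => (k y : ℝ≥0∞) := k.continuous.measurable.coe_nnreal_ennreal
      rw [lintegral_withDensity_eq_lintegral_mul _ hcm hk,
        lintegral_withDensity_eq_lintegral_mul _ hcm hk]
      have := hH (BoundedContinuousFunction.mkOfBound
        ⟨fun y => c y * k y, hc.mul k.continuous⟩ (nndist k 0) fun y z => ?_)
        fun y hy => by simp [hcV y hy]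
      · simpa using this
      · have hb (y : X) : ((c y * k y : ℝ≥0) : ℝ) ≤ nndist k 0 := by
          have h1 : k y ≤ nndist k 0 := by simpa using k.nndist_coe_le_nndist (g := 0) y
          exact_mod_cast (mul_le_of_le_one_left' (hc1 y)).trans h1
        rw [NNReal.dist_eq, abs_sub_le_iff]
        have h1 := hb y
        have h2 := hb z
        have h3 := (c y * k y).coe_nonneg
        have h4 := (c z * k z).coe_nonneg
        exact ⟨by simp only [ContinuousMap.coe_mk]; linarith,
          by simp only [ContinuousMap.coe_mk]; linarith⟩
    refine ⟨{y | c y ≠ 0}, (isOpen_ne_fun hc continuous_const).mem_nhds ?_, ?_⟩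
    · simp [c, hχ1 (mem_singleton x)]
    · have hO : MeasurableSet {y | c y ≠ 0} := (isOpen_ne_fun hc continuous_const).measurableSet
      have h1 := congrArg (fun m : Measure X =>
        (m.restrict {y | c y ≠ 0}).withDensity fun y => (c y : ℝ≥0∞)⁻¹) heq
      simp only [restrict_withDensity hO] at h1
      have h2 (m : Measure X) : ((m.restrict {y | c y ≠ 0}).withDensity
          fun y => (c y : ℝ≥0∞)).withDensity (fun y => (c y : ℝ≥0∞)⁻¹)
          = m.restrict {y | c y ≠ 0} :=
        withDensity_inv_same hcm ((ae_restrict_iff' hO).2 (Eventually.of_forall fun y hy => by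
          simpa using hy)) (Eventually.of_forall fun y => ENNReal.coe_ne_top)
      rwa [h2, h2] at h1
  choose O hO hOeq using key
  obtain ⟨s, hs, hsO⟩ := TopologicalSpace.countable_cover_nhds hO
  exact (Measure.ext_iff_of_biUnion_eq_univ hs hsO).2 fun x _ => hOeq x

/-! ### Passage to the limit in the change of variables formula -/

namespace IsSmoothing

variable {σ a : ℝ} {μ : Measure (CircleDiff 1)} {g F : ℝ → ℝ} {Fs B : ℕ → ℝ → ℝ} {δ : ℕ → ℝ}
  {C : ℝ}

/-- The conjugated approximations converge to `f`. -/
theorem tendsto_rot_mul_mul_rot {f : CircleDiff 1} (hf0 : f 0 = 0) {ψ : ℕ → CircleDiff 1}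
    (hψ : Tendsto ψ atTop (𝓝 f)) {θ : ℕ → ℝ} (hθ : Tendsto θ atTop (𝓝 0)) :
    Tendsto (fun n => CircleDiff.rot (-ψ n (θ n : Circ)) * ψ n * CircleDiff.rot (θ n : Circ))
      atTop (𝓝 f) := by
  have h0 : CircleDiff.rot 0 = 1 := CircleDiff.ext_toFun fun t => add_zero t
  have h1 : Tendsto (fun n => (θ n : Circ)) atTop (𝓝 0) :=
    ((AddCircle.continuous_mk' (1 : ℝ)).tendsto 0).comp hθ
  have h2 : Tendsto (fun n => ψ n (θ n : Circ)) atTop (𝓝 (f 0)) :=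
    (CircleDiff.continuous_eval.tendsto (f, 0)).comp (hψ.prodMk_nhds h1)
  rw [hf0] at h2
  have h3 := (CircleDiff.continuous_rot.tendsto _).comp h2.neg
  have h4 := (CircleDiff.continuous_rot.tendsto _).comp h1
  rw [neg_zero, h0] at h3
  rw [h0] at h4
  simpa using (h3.mul hψ).mul h4

/-- Almost every `φ` is pinned, and there the function is a limit of continuous densities (with `θ =
0`). -/
theorem aemeasurable_pinnedDensity (h : IsSmoothing a g F Fs B δ C) (hg : IsIntervalDiff 3 g)
    (σ : ℝ) (μ : Measure (CircleDiff 1)) (t₀ : ℝ) :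
    AEMeasurable (fun φ => ENNReal.ofReal (Real.sqrt (derivWithin g (Icc 0 1) 0
      * derivWithin g (Icc 0 1) 1) * pinnedDensity σ a t₀ g φ)) (pinnedMeasure μ t₀) := by
  refine aemeasurable_of_tendsto_metrizable_ae' (f := fun n φ => ENNReal.ofReal
    (orbitalDensity σ a (CircleDiff.ofLift _ (h.isCircleLift n))
      (CircleDiff.rot ((0 : ℝ) : Circ) * φ))) (fun n => ?_) ?_
  · exact (((continuous_orbitalDensity σ a _).comp
      (continuous_const_mul _)).measurable.ennreal_ofReal).aemeasurable
  · filter_upwards [ae_pinnedMeasure μ t₀] with φ hφ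
    exact ENNReal.tendsto_ofReal (h.tendsto_orbitalDensity hg σ
      (fun n => CircleDiff.ofLift_coe _ (h.isCircleLift n)) hφ (θ := fun _ => 0) tendsto_const_nhds)

/-- The arc identity for `Fₙ`, divided by `εₙ`, is passed to the limit. The neighbourhood `V` is
chosen so that all integrands eventually live on one set of finite measure where `φ'` is bounded. -/
theorem lintegral_pinned_eq (h : IsSmoothing a g F Fs B δ C) (hg : IsIntervalDiff 3 g)
    (hμ : IsOrbitalMeasure σ a μ) (t₀ : ℝ) {f : CircleDiff 1} (hF : IsCircleLift 1 F)
    (hF0 : F 0 = 0) (hf : ∀ x : ℝ, f (x : Circ) = (F x : Circ)) (φ₁ : CircleDiff 1) :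
    ∃ V, IsOpen V ∧ φ₁ ∈ V ∧ pinnedMeasure μ t₀ V < ∞ ∧
      ∀ H : CircleDiff 1 →ᵇ ℝ≥0, (∀ φ ∉ V, H φ = 0) →
        ENNReal.ofReal (deriv F 0) * ∫⁻ φ, H φ ∂pinnedMeasure μ t₀
          = ∫⁻ φ, ENNReal.ofReal (Real.sqrt (derivWithin g (Icc 0 1) 0
            * derivWithin g (Icc 0 1) 1) * pinnedDensity σ a t₀ g φ) * H (f * φ)
              ∂pinnedMeasure μ t₀ := by
  have hν := hμ.isLocallyFiniteMeasure_pinned t₀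
  set ν := pinnedMeasure μ t₀
  obtain ⟨U₀, hφU₀, hU₀, hνU₀⟩ := ν.exists_isOpen_measure_lt_top (f⁻¹ * φ₁)
  obtain ⟨V₀, hφV₀, hV₀, hνV₀⟩ := ν.exists_isOpen_measure_lt_top φ₁
  set R := ‖(CircleDiff.toC1 (f⁻¹ * φ₁)).2‖ + 1
  set U := U₀ ∩ {φ | ‖(CircleDiff.toC1 φ).2‖ < R}
  have hU : IsOpen U := hU₀.inter
    (isOpen_lt (continuous_norm.comp CircleDiff.continuous_snd_toC1) continuous_const)
  have hφU : f⁻¹ * φ₁ ∈ U := ⟨hφU₀, by simp [R]⟩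
  have hνU : ν U < ∞ := (measure_mono inter_subset_left).trans_lt hνU₀
  have hUR {φ : CircleDiff 1} (hφ : φ ∈ U) (t : Circ) : φ.deriv t ≤ R :=
    ((le_abs_self _).trans ((CircleDiff.toC1 φ).2.norm_coe_le_norm t)).trans hφ.2.le
  have hcont : Continuous fun p : CircleDiff 1 × CircleDiff 1 => p.1⁻¹ * p.2 := by fun_prop
  -- If `k` is close to `f` and `k * φ` is close to `φ₁`, then `φ` lies in `U`. Applied to the
  -- conjugated approximations, this puts the supports of the integrands in `U`.
  obtain ⟨W, hW, V₁, hV₁, hWV⟩ := mem_nhds_prod_iff.1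
    (hcont.continuousAt.preimage_mem_nhds (x := (f, φ₁)) (hU.mem_nhds hφU))
  obtain ⟨V₂, hV₂V₁, hV₂, hφV₂⟩ := mem_nhds_iff.1 hV₁
  refine ⟨V₀ ∩ V₂, hV₀.inter hV₂, ⟨hφV₀, hφV₂⟩,
    (measure_mono inter_subset_left).trans_lt hνV₀, fun H hH => ?_⟩
  have hHm : Measurable fun φ => (H φ : ℝ≥0∞) := H.continuous.measurable.coe_nnreal_ennreal
  set ψ : ℕ → CircleDiff 3 := fun n => CircleDiff.ofLift _ (h.isCircleLift n)
  have hψ (n : ℕ) (x : ℝ) : ψ n (x : Circ) = (Fs n x : Circ) :=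
    CircleDiff.ofLift_coe _ (h.isCircleLift n) x
  have hψf : Tendsto (fun n => (ψ n).ofLE (by norm_num : 1 ≤ 3)) atTop (𝓝 f) :=
    h.tendsto_circleDiff hF hF0 hf hψ
  have hf0 : f 0 = 0 := by
    have := hf 0
    rwa [hF0, AddCircle.coe_zero] at this
  set I : ℕ → ℝ → ℝ≥0∞ := fun n θ =>
    ∫⁻ φ, ENNReal.ofReal (orbitalDensity σ a (ψ n) (CircleDiff.rot θ * φ))
      * H (CircleDiff.rot (-ψ n (θ : Circ)) * (ψ n).ofLE (by norm_num : 1 ≤ 3)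
        * CircleDiff.rot θ * φ) ∂ν
  set I₀ := ∫⁻ φ, ENNReal.ofReal (Real.sqrt (derivWithin g (Icc 0 1) 0
    * derivWithin g (Icc 0 1) 1) * pinnedDensity σ a t₀ g φ) * H (f * φ) ∂ν
  obtain ⟨c, hc⟩ : ∃ c : ℝ≥0, ∀ φ, H φ ≤ c :=
    ⟨nndist H 0, fun φ => by simpa using H.nndist_coe_le_nndist (g := 0) φ⟩
  have hlim (θ : ℕ → ℝ) (hθ : Tendsto θ atTop (𝓝 0)) :
      Tendsto (fun n => I n (θ n)) atTop (𝓝 I₀) := by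
    have hconj := tendsto_rot_mul_mul_rot hf0 hψf hθ
    refine tendsto_lintegral_filter_of_dominated_convergence
      (U.indicator fun _ => ENNReal.ofReal (Real.exp (1 / σ ^ 2 *
        (|intervalLogDeriv g 0 - intervalLogDeriv g 1| * R + C * R ^ 2))) * c)
      (Eventually.of_forall fun n => ?_) ?_ ?_ ?_
    · exact ((continuous_orbitalDensity σ a _).comp
        (continuous_const_mul _)).measurable.ennreal_ofReal.mul
        (hHm.comp (continuous_const_mul _).measurable)
    · filter_upwards [hconj hW] with n hn
      refine Eventually.of_forall fun φ => ?_
      by_cases hφ : φ ∈ U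
      · rw [indicator_of_mem hφ]
        exact mul_le_mul' (ENNReal.ofReal_le_ofReal
          (h.orbitalDensity_rot_mul_le σ hψ (hUR hφ) n (θ n))) (by exact_mod_cast hc _)
      · rw [indicator_of_notMem hφ, hH _ fun hmem => hφ ?_]
        · simp
        · have := hWV (mk_mem_prod hn (hV₂V₁ hmem.2))
          exact (congrArg (· ∈ U) (inv_mul_cancel_left (CircleDiff.rot (-ψ n (θ n : Circ))
            * (ψ n).ofLE (by norm_num : 1 ≤ 3) * CircleDiff.rot (θ n : Circ)) φ)).mp this
    · rw [lintegral_indicator hU.measurableSet, setLIntegral_const]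
      exact ENNReal.mul_ne_top (ENNReal.mul_ne_top ENNReal.ofReal_ne_top ENNReal.coe_ne_top)
        hνU.ne
    · filter_upwards [ae_pinnedMeasure μ t₀] with φ hφ
      refine ENNReal.Tendsto.mul (ENNReal.tendsto_ofReal (h.tendsto_orbitalDensity hg σ hψ hφ hθ))
        (Or.inr ENNReal.coe_ne_top) (ENNReal.tendsto_coe.2 ((H.continuous.tendsto _).comp
          (hconj.mul_const φ))) (Or.inr ENNReal.ofReal_ne_top)
  -- Any null sequence in `(0, 1)` would do.
  set ε : ℕ → ℝ := fun n => 1 / ((n : ℝ) + 1 + 1)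
  have hε (n : ℕ) : ε n ∈ Ioo (0 : ℝ) 1 := by
    refine ⟨by positivity, ?_⟩
    rw [div_lt_one (by positivity)]
    linarith [(Nat.cast_nonneg n : (0 : ℝ) ≤ n)]
  have hε0 : Tendsto ε atTop (𝓝 0) := by
    have := (tendsto_one_div_add_atTop_nhds_zero_nat (𝕜 := ℝ)).comp (tendsto_add_atTop_nat 1)
    refine this.congr fun n => ?_
    simp [ε]
  have hHfin : ∫⁻ φ, H φ ∂ν ≠ ∞ := by
    refine ne_of_lt (lt_of_le_of_lt (b := ∫⁻ φ, V₀.indicator (fun _ => (c : ℝ≥0∞)) φ ∂ν) ?_ ?_)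
    · refine lintegral_mono fun φ => ?_
      by_cases hφ : φ ∈ V₀
      · rw [indicator_of_mem hφ]
        exact ENNReal.coe_le_coe.2 (hc φ)
      · rw [hH φ fun hm => hφ hm.1]
        simp
    · rw [lintegral_indicator hV₀.measurableSet, setLIntegral_const]
      exact ENNReal.mul_lt_top ENNReal.coe_lt_top hνV₀
  have hImeas (n : ℕ) : Measurable (I n) := by
    have hrot : Continuous fun p : ℝ × CircleDiff 1 => CircleDiff.rot (p.1 : Circ) :=
      CircleDiff.continuous_rot.comp ((AddCircle.continuous_mk' (1 : ℝ)).comp continuous_fst)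
    have hψc : Continuous fun p : ℝ × CircleDiff 1 => CircleDiff.rot (-ψ n (p.1 : Circ)) :=
      CircleDiff.continuous_rot.comp (((ψ n).continuous_coe.comp
        ((AddCircle.continuous_mk' (1 : ℝ)).comp continuous_fst)).neg)
    exact Measurable.lintegral_prod_right' (((continuous_orbitalDensity σ a (ψ n)).comp
      (hrot.mul continuous_snd)).measurable.ennreal_ofReal.mul
        (hHm.comp (((hψc.mul continuous_const).mul hrot).mul continuous_snd).measurable))
  have havg (n : ℕ) : ⨍⁻ θ in Ioc 0 (ε n), I n θ ∂volume
      = ENNReal.ofReal (Fs n (ε n) / ε n) * ∫⁻ φ, H φ ∂ν := by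
    rw [setLAverage_eq, ← hμ.lintegral_pinned_arc t₀ (h.isCircleLift n) (h.map_zero n) (hψ n)
      (hε n) hHm, Real.volume_Ioc, sub_zero, ENNReal.ofReal_div_of_pos (hε n).1,
      ENNReal.mul_div_right_comm]
  have hvol (n : ℕ) : volume (Ioc 0 (ε n)) ≠ 0 := by simpa using (hε n).1
  have hvol' (n : ℕ) : volume (Ioc 0 (ε n)) ≠ ∞ := by simp
  have havg_lim : Tendsto (fun n => ⨍⁻ θ in Ioc 0 (ε n), I n θ ∂volume) atTop
      (𝓝 (ENNReal.ofReal (deriv F 0) * ∫⁻ φ, H φ ∂ν)) := by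
    simp only [havg]
    exact ENNReal.Tendsto.mul_const (ENNReal.tendsto_ofReal
      (h.tendsto_div hF hF0 (fun n => (hε n).1) hε0)) (Or.inr hHfin)
  have hzero {θ : ℕ → ℝ} (hθ : ∀ n, θ n ∈ Ioc 0 (ε n)) : Tendsto θ atTop (𝓝 0) :=
    squeeze_zero (fun n => (hθ n).1.le) (fun n => (hθ n).2) hε0
  -- Convergence of `I n (θ n)` is known along every null sequence `θ`. In each arc some `θ` has `I
  -- n θ` at least the average and another at most the average; along both choices the limit is
  -- `I₀`, which squeezes the averages.
  refine le_antisymm ?_ ?_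
  · have hex (n : ℕ) : ∃ θ ∈ Ioc 0 (ε n), ⨍⁻ θ in Ioc 0 (ε n), I n θ ∂volume ≤ I n θ := by
      refine exists_setLAverage_le (hvol n) measurableSet_Ioc.nullMeasurableSet ?_
      rw [← hμ.lintegral_pinned_arc t₀ (h.isCircleLift n) (h.map_zero n) (hψ n)
        (hε n) hHm]
      exact ENNReal.mul_ne_top ENNReal.ofReal_ne_top hHfin
    choose θ hθ hle using hex
    exact le_of_tendsto_of_tendsto' havg_lim (hlim θ (hzero hθ)) hle
  · choose θ hθ hle using fun n =>
      exists_le_setLAverage (hvol n) (hvol' n) (hImeas n).aemeasurable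
    exact le_of_tendsto_of_tendsto' (hlim θ (hzero hθ)) havg_lim hle

end IsSmoothing

theorem CircleDiff.exists_isCircleLift_eqOn {f : CircleDiff 1} {g : ℝ → ℝ}
    (hg : ContinuousOn g (Icc 0 1))
    (hfg : ∀ x ∈ Icc (0 : ℝ) 1, f (x : Circ) = (g x : Circ)) :
    ∃ F, IsCircleLift 1 F ∧ (∀ x : ℝ, f (x : Circ) = (F x : Circ)) ∧
      ∀ x ∈ Icc (0 : ℝ) 1, F x = g x := by
  have hf := f.isCircleLift_lift
  obtain ⟨n, hn⟩ := exists_int_eqOn_of_coe_eq isPreconnected_Icc hf.continuous.continuousOn hg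
    fun x hx => by rw [← f.coe_lift, hfg x hx]
  refine ⟨fun x => f.lift x - n, ⟨hf.contDiff.sub contDiff_const, fun x => ?_, fun x => ?_⟩,
    fun x => ?_, fun x hx => ?_⟩
  · simpa using hf.deriv_pos x
  · rw [hf.add_one]
    ring
  · rw [f.coe_lift]
    exact coe_circ_eq_iff.2 ⟨n, by ring⟩
  · simp only [hn x hx]
    ring

theorem pinnedDensity_pos {g : ℝ → ℝ} (hg : IsIntervalDiff 3 g) (σ a : ℝ) (t₀ : Circ)
    (φ : CircleDiff 1) : 0 < pinnedDensity σ a t₀ g φ :=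
  mul_pos (one_div_pos.2 (Real.sqrt_pos.2 (mul_pos (hg.deriv_pos 0 (by simp))
    (hg.deriv_pos 1 (by simp))))) (Real.exp_pos _)

/-- `f ∈ Diff¹(𝕋) ∩ Diff³[0,1]` is a diffeomorphism `f` of the circle given on `[0,1]` by
`g ∈ Diff³[0,1]`. -/
theorem mainTheorem6 (σ : ℝ) (hσ : 0 < σ) (a : ℝ) (μ : Measure (CircleDiff 1))
    (hμ : IsOrbitalMeasure σ a μ) (t₀ : Circ) (f : CircleDiff 1) (g : ℝ → ℝ)
    (hg : IsIntervalDiff 3 g) (hfg : ∀ x ∈ Icc (0 : ℝ) 1, f (x : Circ) = (g x : Circ)) :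
    pullbackMeasure f (pinnedMeasure μ t₀) ≪ pinnedMeasure μ t₀ ∧
    pinnedMeasure μ t₀ ≪ pullbackMeasure f (pinnedMeasure μ t₀) ∧
    (pullbackMeasure f (pinnedMeasure μ t₀)).rnDeriv (pinnedMeasure μ t₀)
      =ᵐ[pinnedMeasure μ t₀] (fun φ => ENNReal.ofReal (pinnedDensity σ a t₀ g φ)) ∧
    pullbackMeasure f (pinnedMeasure μ t₀)
      = (pinnedMeasure μ t₀).withDensity (fun φ => ENNReal.ofReal (pinnedDensity σ a t₀ g φ)) := by
  obtain ⟨t₀, rfl⟩ := exists_coe_circ t₀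
  obtain ⟨F, hF, hf, hFg⟩ := CircleDiff.exists_isCircleLift_eqOn hg.contDiffOn.continuousOn hfg
  have hF0 : F 0 = 0 := (hFg 0 (by simp)).trans hg.map_zero
  have hd0 : derivWithin g (Icc 0 1) 0 = deriv F 0 :=
    IsIntervalDiff.derivWithin_eq_deriv hF hFg (by simp)
  have hd1 : derivWithin g (Icc 0 1) 1 = deriv F 0 := by
    rw [IsIntervalDiff.derivWithin_eq_deriv hF hFg (by simp)]
    simpa using hF.periodic_deriv 0
  have hpos : 0 < deriv F 0 := hF.deriv_pos 0
  -- On the circle the one-sided derivatives agree, so the symmetric prefactor is `1 / F'(0)`, the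
  -- inverse of the limiting arc ratio.
  have hsqrt : Real.sqrt (derivWithin g (Icc 0 1) 0 * derivWithin g (Icc 0 1) 1)
      = deriv F 0 := by
    rw [hd0, hd1, Real.sqrt_mul_self hpos.le]
  obtain ⟨Fs, B, δ, C, h⟩ := exists_isSmoothing a hg hF hFg
  have hν := hμ.isLocallyFiniteMeasure_pinned t₀
  set ν := pinnedMeasure μ t₀
  set d := ENNReal.ofReal (deriv F 0)
  have hd : d ≠ 0 := by simpa [d] using hpos
  have hd' : d ≠ ∞ := ENNReal.ofReal_ne_top
  set p : CircleDiff 1 → ℝ≥0∞ := fun φ => ENNReal.ofReal (pinnedDensity σ a t₀ g φ)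
  have hE : (fun φ => ENNReal.ofReal (Real.sqrt (derivWithin g (Icc 0 1) 0
      * derivWithin g (Icc 0 1) 1) * pinnedDensity σ a t₀ g φ)) = d • p := by
    funext φ
    rw [hsqrt, ENNReal.ofReal_mul hpos.le]
    rfl
  have hEm : AEMeasurable (d • p) ν := hE ▸ h.aemeasurable_pinnedDensity hg σ μ t₀
  have hpm : AEMeasurable p ν := by
    refine (hEm.const_smul d⁻¹).congr (Eventually.of_forall fun φ => ?_)
    simp [← mul_assoc, ENNReal.inv_mul_cancel hd hd']
  have hm : Measurable fun φ => f * φ := (continuous_const_mul f).measurable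
  -- This is the limit identity read as an equality of measures; cancelling the finite nonzero
  -- factor `d` gives the formula.
  have hmap : d • ν = (ν.withDensity (d • p)).map (f * ·) := by
    refine Measure.ext_of_forall_lintegral_eq_locally fun φ₁ => ?_
    obtain ⟨V, hV, hφV, hνV, hH⟩ := h.lintegral_pinned_eq hg hμ t₀ hF hF0 hf φ₁
    refine ⟨V, hV, hφV, ?_, fun H hHV => ?_⟩
    · rw [Measure.smul_apply, smul_eq_mul]
      exact ENNReal.mul_lt_top hd'.lt_top hνV
    · have hHm : Measurable fun φ => (H φ : ℝ≥0∞) := H.continuous.measurable.coe_nnreal_ennreal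
      rw [lintegral_smul_measure, lintegral_map hHm hm,
        lintegral_withDensity_eq_lintegral_mul₀ hEm
          (g := fun φ => (H (f * φ) : ℝ≥0∞)) (hHm.comp hm).aemeasurable, ← hE]
      exact hH H hHV
  have hpull : pullbackMeasure f ν = ν.withDensity p := by
    rw [pullbackMeasure_eq_iff]
    rw [withDensity_smul' _ _ hd', Measure.map_smul] at hmap
    have := congrArg (d⁻¹ • ·) hmap
    simpa [smul_smul, ENNReal.inv_mul_cancel hd hd'] using this.symm
  have hpne : ∀ᵐ φ ∂ν, p φ ≠ 0 := Eventually.of_forall fun φ => by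
    simpa [p] using pinnedDensity_pos hg σ a t₀ φ
  rw [hpull]
  exact ⟨withDensity_absolutelyContinuous _ _, withDensity_absolutelyContinuous' hpm hpne,
    Measure.rnDeriv_withDensity₀ ν hpm, rfl⟩
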